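/- **Setting.** $N\ge 1$ agents, connected in a complete graph, minimize $F(\boldsymbol x)=\sum_{i=1}^N f_i(\boldsymbol x)$ over a nonempty closed convex set $\mathcal C\subseteq\mathbb R^d$. The function $f_i:\mathcal C\to\mathbb R$ is private to agent $i$; it is differentiable and belongs to a set $\mathscr F_i$. Let $\|\cdot\|$ be the $l_2$ norm and $\|\cdot\|_1$ the $l_1$ norm, and let $m,M,C_1,B_1>0$. Assume that for every $i$, every $f,g\in\mathscr F_i$ and all $\boldsymbol x,\boldsymbol y\in\mathcal C$, * ($m$-strong convexity) $m\|\boldsymbol x-\boldsymbol y\|^2\le(\boldsymbol x-\boldsymbol y)^T(\nabla f(\boldsymbol x)-\nabla f(\boldsymbol y))$; * ($M$-smoothness) $\|\nabla f(\boldsymbol x)-\nabla f(\boldsymbol y)\|\le M\|\boldsymbol x-\boldsymbol y\|$; * (bounded gradient) $\|\nabla f(\boldsymbol x)\|_1\le C_1$; * ($l_1$ sensitivity $B_1$) $\|\nabla f(\boldsymbol x)-\nabla g(\boldsymbol x)\|_1\le B_1$. **Algorithm (noisy decentralized gradient descent)** with $K$ rounds, step size $\eta>0$ and noise level $\sigma\ge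 0$. Start from arbitrary data-independent $\boldsymbol x_1^0,\dots,\boldsymbol x_N^0\in\mathcal C$. For $0\le k\le K$ let $\bar{\boldsymbol x}^k=\Pi_{\mathcal C}\big(\frac1N\sum_{i}\boldsymbol x_i^k\big)$, with $\Pi_{\mathcal C}$ the Euclidean projection onto $\mathcal C$. For $0\le k<K$ every agent $i$ computes and publishes $$\boldsymbol x_i^{k+1}=\bar{\boldsymbol x}^k-\eta\nabla f_i(\bar{\boldsymbol x}^k)+\boldsymbol\Delta_i^{k+1},\qquad \boldsymbol\Delta_i^{k+1}\sim\mathcal N(\boldsymbol 0,\sigma^2\boldsymbol I_d)\ \text{independent}.$$ The output is $\bar{\boldsymbol x}^K$. The algorithm achieves $(\varepsilon,\delta)$-LDP if, for every $i$, any two inputs $(f_1,\dots,f_i,\dots,f_N)$ and $(f_1,\dots,\hat f_i,\dots,f_N)$ with $f_j\in\mathscr F_j$ for all $j$ and $\hat f_i\in\mathscr F_i$, and every measurable set $S$, the published transcript $\boldsymbol X=(\boldsymbol x_j^k)_{0\le k\le K,\,1\le j\le N}$ satisfies $$\Pr[\boldsymbol X\in S\mid f_1,\dots,f_i,\dots,f_N]\le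 e^{\varepsilon}\Pr[\boldsymbol X\in S\mid f_1,\dots,\hat f_i,\dots,f_N]+\delta .$$ **Theorem.** There are absolute constants $A>0$ and $p\in\mathbb N$ such that the following holds. For all $N\ge1$, $d$, $m,M,C_1,B_1>0$, $0<\delta<1$ and $0<\varepsilon\le 1+\log(1/\delta)$ there are $K$, $\eta$, $\sigma$, depending only on these numbers, such that for all $\mathcal C$, $\mathscr F_1,\dots,\mathscr F_N$ and initial points as above, the algorithm achieves $(\varepsilon,\delta)$-LDP, and for all $f_1\in\mathscr F_1,\dots,f_N\in\mathscr F_N$ the function $F$ has a minimizer $\boldsymbol x^*$ on $\mathcal C$, $F(\bar{\boldsymbol x}^K)$ is integrable, and the expected utility loss satisfies $$\mathbb E\Big[\sum_{i=1}^N f_i(\bar{\boldsymbol x}^K)\Big]-\sum_{i=1}^N f_i(\boldsymbol x^*)\ \le\ A\,\frac{\sqrt M\,N\,C_1B_1}{m^{3/2}\,\varepsilon}\,\Big(\log\big(2+d+\tfrac Mm+\tfrac1\delta+\tfrac{C_1}{B_1}\big)\Big)^{p}.$$ In particular the utility loss is $\tilde O\big(\sqrt M N C_1B_1/(m^{3/2}\varepsilon)\big)$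 and depends on $d$ only through a power of a logarithm. -/

import Mathlib

open MeasureTheory ProbabilityTheory

namespace DecGD

noncomputable section

/-- The parameter space `ℝ^d` with its Euclidean structure. -/
abbrev Space (d : ℕ) : Type := EuclideanSpace ℝ (Fin d)

/-- The `l_1` norm of a vector. -/
def l1Norm {d : ℕ} (v : Space d) : ℝ := ∑ l, |v l|

/-- A differentiable loss function `C → ℝ` together with its gradient on `C`. The values of `val`
and `grad` outside `C` play no role anywhere. -/
structure LossFunction {d : ℕ} (C : Set (Space d)) where
  val : Space d → ℝ
  grad : Space d → Space d
  hasGradient : ∀ x ∈ C, HasGradientWithinAt val (grad x) C x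

variable {d : ℕ} {C : Set (Space d)}

/-- `f` is `m`-strongly convex on `C`. -/
def LossFunction.IsStronglyConvex (f : LossFunction C) (m : ℝ) : Prop :=
  ∀ x ∈ C, ∀ y ∈ C, m * ‖x - y‖ ^ 2 ≤ inner ℝ (x - y) (f.grad x - f.grad y)

/-- `f` is `M`-smooth on `C`: its gradient is `M`-Lipschitz. -/
def LossFunction.IsSmooth (f : LossFunction C) (M : ℝ) : Prop :=
  ∀ x ∈ C, ∀ y ∈ C, ‖f.grad x - f.grad y‖ ≤ M * ‖x - y‖

/-- The gradient of `f` is bounded by `C₁` in the `l_1` norm on `C`. -/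
def LossFunction.GradBounded (f : LossFunction C) (C₁ : ℝ) : Prop :=
  ∀ x ∈ C, l1Norm (f.grad x) ≤ C₁

/-- A set of loss functions has local `l_1` sensitivity at most `B₁`: the gradients of any two
members differ by at most `B₁` in the `l_1` norm, at every point of `C`. -/
def HasSensitivity (F : Set (LossFunction C)) (B₁ : ℝ) : Prop :=
  ∀ f ∈ F, ∀ g ∈ F, ∀ x ∈ C, l1Norm (f.grad x - g.grad x) ≤ B₁

/-- The global objective `x ↦ ∑ i, f i x` of the consensus problem. -/
def objective {N : ℕ} (f : Fin N → LossFunction C) (x : Space d) : ℝ := ∑ i, (f i).val x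

open Classical in
/-- Euclidean projection onto `C`: a point of `C` nearest to `x` (it exists and is unique when `C`
is nonempty, closed and convex). -/
def proj (C : Set (Space d)) (x : Space d) : Space d :=
  if h : ∃ p ∈ C, dist x p = Metric.infDist x C then h.choose else x

/-- The aggregate `x̄` formed from the broadcast estimates of the `N` agents: their average,
projected onto the constraint set. -/
def aggregate {N : ℕ} (C : Set (Space d)) (x : Fin N → Space d) : Space d :=
  proj C ((N : ℝ)⁻¹ • ∑ i, x i)

/-- The estimates `(x_i^k)_i` broadcast by the agents at round `k` of noisy decentralized gradient
descent with step size `η` and noise level `σ`, started at `x0`, where `Z k i` is the noise drawn by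
agent `i` in the step leading to round `k + 1`:
`x_i^{k+1} = x̄^k - η ∇f_i(x̄^k) + σ Z_i^k`. -/
def iterate {N : ℕ} (f : Fin N → LossFunction C) (η σ : ℝ) (x0 : Fin N → Space d)
    (Z : ℕ → Fin N → Space d) : ℕ → Fin N → Space d
  | 0 => x0
  | k + 1 => fun i =>
      aggregate C (iterate f η σ x0 Z k)
        - η • (f i).grad (aggregate C (iterate f η σ x0 Z k)) + σ • Z k i

/-- Noise of a run of `K` rounds, one vector for each round and each agent. -/
abbrev Noise (d N K : ℕ) : Type := Fin K → Fin N → Space d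

/-- The law of the noise: all vectors independent and standard Gaussian on `ℝ^d`. -/
def noiseLaw (d N K : ℕ) : Measure (Noise d N K) :=
  Measure.pi fun _ => Measure.pi fun _ => stdGaussian (Space d)

/-- Padding by `0`: rounds after the last one are never run. -/
def Noise.extend {N K : ℕ} (ω : Noise d N K) (k : ℕ) : Fin N → Space d :=
  if h : k < K then ω ⟨k, h⟩ else 0

/-- Everything that the agents publish in a run of `K` rounds: all estimates `x_i^k`,
`0 ≤ k ≤ K`. -/
def transcript {N K : ℕ} (f : Fin N → LossFunction C) (η σ : ℝ) (x0 : Fin N → Space d)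
    (ω : Noise d N K) : Fin (K + 1) → Fin N → Space d :=
  fun k => iterate f η σ x0 ω.extend k

/-- The final output `x̄^K` of a run of `K` rounds. -/
def output {N K : ℕ} (f : Fin N → LossFunction C) (η σ : ℝ) (x0 : Fin N → Space d)
    (ω : Noise d N K) : Space d :=
  aggregate C (iterate f η σ x0 ω.extend K)

/-- `(ε, δ)`-local differential privacy of a randomized protocol, given by the published data
`T f ω` on input `f` (one private function per agent, that of agent `i` from the set `F i`) and
randomness `ω ∼ μ`: for any two inputs which differ only in the function of one agent, the laws of
the published data are `(ε, δ)`-indistinguishable. -/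
def IsLDP {N : ℕ} {Θ Ω X : Type*} [MeasurableSpace Ω] [MeasurableSpace X]
    (F : Fin N → Set Θ) (μ : Measure Ω) (T : (Fin N → Θ) → Ω → X) (ε δ : ℝ) : Prop :=
  ∀ f g : Fin N → Θ, (∀ j, f j ∈ F j) → (∀ j, g j ∈ F j) →
    ∀ i, (∀ j, j ≠ i → f j = g j) →
      ∀ S : Set X, MeasurableSet S →
        μ (T f ⁻¹' S) ≤ ENNReal.ofReal (Real.exp ε) * μ (T g ⁻¹' S) + ENNReal.ofReal δ

end

end DecGD

/-! Privacy. The published state determines the next aggregate, so replacing one agent's function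
merely translates that agent's standard Gaussian vector, by at most `η * B₁ / σ`. Rényi-type bounds
are used in the dual form `HolderDom`: its constants add under adaptive composition
(`HolderDom.prod`), a translation by `v` costs `‖v‖ ^ 2 / (2 * (q - 1))`, and `HolderDom.measure_le`
converts the total into (ε, δ). So σ of order η B₁ √(K (1 + log(1/δ))) / ε suffices
(`isLDP_transcript`).

Utility. The aggregates perform projected gradient descent with step 1/M on the average loss,
perturbed by the mean noise ξ of the agents. A bound through E‖ξ‖² would be polynomial in d. Instead
the term E⟨ξ, x' - y⟩ is kept, with y independent of ξ; it is at most σ times the Gaussian width w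
of C (`integral_inner_meanNoise_le`). That width is C₁/m up to logarithms
(`LossFunction.hasWidthLE`): strong convexity makes the inverse gradient map m⁻¹-Lipschitz,
gradients lie in an l_1 ball of radius C₁, and Maurey's nets of that ball are small enough for
chaining.

Each round thus costs V = M σ w. About (M/m) log rounds contract the initial distance, and
`last_iterate_le` bounds the final gap by V up to a logarithm. For such K, V is of order √(M/m) C₁
B₁ / (m ε) up to logarithms; the factor N comes from passing from the average to the sum. -/

open scoped ENNReal

namespace DecGD

/-! ### Hölder domination: composition and conversion to privacy. -/

/-- Hölder domination: the law of `φ` under `μ` is dominated by the law of `ψ`, in the sense that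
`E h(φ) ≤ exp c * (E h(ψ)^q)^(1/q)` for all measurable `h ≥ 0`. It is the dual form of a bound on
the Rényi divergence of the two laws. -/
def HolderDom {Ω X : Type*} [MeasurableSpace Ω] [MeasurableSpace X] (q c : ℝ) (μ : Measure Ω)
    (φ ψ : Ω → X) : Prop :=
  ∀ h : X → ℝ≥0∞, Measurable h →
    ∫⁻ ω, h (φ ω) ∂μ ≤ ENNReal.ofReal (Real.exp c) * (∫⁻ ω, h (ψ ω) ^ q ∂μ) ^ (1 / q)

namespace HolderDom

variable {Ω Ω' X Y : Type*} [MeasurableSpace Ω] [MeasurableSpace Ω'] [MeasurableSpace X]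
  [MeasurableSpace Y] {q c c' : ℝ} {μ : Measure Ω} {φ ψ : Ω → X}

theorem refl [IsProbabilityMeasure μ] (hq : 1 < q) (hφ : Measurable φ) :
    HolderDom q 0 μ φ φ := by
  intro h hh
  have hpq := Real.HolderConjugate.conjExponent hq
  have := ENNReal.lintegral_mul_le_Lp_mul_Lq μ hpq (f := fun ω => h (φ ω)) (g := fun _ => 1)
    (hh.comp hφ).aemeasurable aemeasurable_const
  simpa using this

theorem mono (hcc : c ≤ c') (H : HolderDom q c μ φ ψ) : HolderDom q c' μ φ ψ := by
  intro h hh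
  refine (H h hh).trans ?_
  gcongr

theorem postcomp {e : X → Y} (he : Measurable e) (H : HolderDom q c μ φ ψ) :
    HolderDom q c μ (fun ω => e (φ ω)) (fun ω => e (ψ ω)) :=
  fun h hh => H (fun x => h (e x)) (hh.comp he)

theorem precomp {ν : Measure Ω'} {π : Ω' → Ω} (hπ : MeasurePreserving π ν μ)
    (hφ : Measurable φ) (hψ : Measurable ψ) (H : HolderDom q c μ φ ψ) :
    HolderDom q c ν (fun ω => φ (π ω)) (fun ω => ψ (π ω)) := by
  intro h hh
  rw [hπ.lintegral_comp (f := fun x => h (φ x)) (hh.comp hφ),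
    hπ.lintegral_comp (f := fun x => h (ψ x) ^ q) ((hh.comp hψ).pow_const q)]
  exact H h hh

/-- Adaptive composition of two mechanisms. -/
theorem prod {ν : Measure Ω'} [SFinite ν] (hq : 0 < q)
    {φ' ψ' : X → Ω' → Y} (hφ : Measurable φ) (hψ : Measurable ψ)
    (hφ' : Measurable (Function.uncurry φ')) (hψ' : Measurable (Function.uncurry ψ'))
    (H : HolderDom q c μ φ ψ) (H' : ∀ x, HolderDom q c' ν (φ' x) (ψ' x)) :
    HolderDom q (c + c') (μ.prod ν) (fun ω => (φ ω.1, φ' (φ ω.1) ω.2))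
      (fun ω => (ψ ω.1, ψ' (ψ ω.1) ω.2)) := by
  intro h hh
  have hm : ∀ {φ₁ : Ω → X} {φ₂ : X → Ω' → Y}, Measurable φ₁ → Measurable (Function.uncurry φ₂) →
      Measurable fun ω : Ω × Ω' => h (φ₁ ω.1, φ₂ (φ₁ ω.1) ω.2) := by
    intro φ₁ φ₂ h₁ h₂
    have h₃ : Measurable fun ω : Ω × Ω' => φ₂ (φ₁ ω.1) ω.2 :=
      h₂.comp ((h₁.comp measurable_fst).prodMk measurable_snd)
    exact hh.comp ((h₁.comp measurable_fst).prodMk h₃)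
  have hG : Measurable fun x => (∫⁻ ω', h (x, ψ' x ω') ^ q ∂ν) ^ (1 / q) := by
    refine Measurable.pow_const (Measurable.lintegral_prod_right'
      (f := fun z : X × Ω' => h (z.1, ψ' z.1 z.2) ^ q) ?_) _
    exact (hh.comp (measurable_fst.prodMk hψ')).pow_const q
  rw [lintegral_prod _ (hm hφ hφ').aemeasurable,
    lintegral_prod _ ((hm hψ hψ').pow_const q).aemeasurable]
  -- The conditional L^q norm of `h` given the first output is itself a test function for `H`, and
  -- its q-th power undoes the root.
  calc ∫⁻ ω, ∫⁻ ω', h (φ ω, φ' (φ ω) ω') ∂ν ∂μ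
      ≤ ∫⁻ ω, ENNReal.ofReal (Real.exp c') *
          (∫⁻ ω', h (φ ω, ψ' (φ ω) ω') ^ q ∂ν) ^ (1 / q) ∂μ :=
        lintegral_mono fun ω =>
          H' (φ ω) (fun y => h (φ ω, y)) (hh.comp measurable_prodMk_left)
    _ = ENNReal.ofReal (Real.exp c') *
          ∫⁻ ω, (∫⁻ ω', h (φ ω, ψ' (φ ω) ω') ^ q ∂ν) ^ (1 / q) ∂μ :=
        lintegral_const_mul _ (hG.comp hφ)
    _ ≤ ENNReal.ofReal (Real.exp c') * (ENNReal.ofReal (Real.exp c) *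
          (∫⁻ ω, ((∫⁻ ω', h (ψ ω, ψ' (ψ ω) ω') ^ q ∂ν) ^ (1 / q)) ^ q ∂μ) ^ (1 / q)) := by
        gcongr
        exact H (fun x => (∫⁻ ω', h (x, ψ' x ω') ^ q ∂ν) ^ (1 / q)) hG
    _ = ENNReal.ofReal (Real.exp (c + c')) *
          (∫⁻ ω, ∫⁻ ω', h (ψ ω, ψ' (ψ ω) ω') ^ q ∂ν ∂μ) ^ (1 / q) := by
        simp_rw [← ENNReal.rpow_mul, one_div_mul_cancel hq.ne', ENNReal.rpow_one]
        rw [← mul_assoc, ← ENNReal.ofReal_mul (Real.exp_nonneg _), ← Real.exp_add, add_comm c']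

/-- Composition over the coordinates of a product measure. -/
theorem pi {E : Type*} [MeasurableSpace E] {γ : Measure E} [IsProbabilityMeasure γ] (hq : 1 < q) :
    ∀ {n : ℕ} {φ : Fin n → E → E} {c : Fin n → ℝ}, (∀ l, Measurable (φ l)) →
      (∀ l, HolderDom q (c l) γ (φ l) id) →
      HolderDom q (∑ l, c l) (Measure.pi fun _ : Fin n => γ) (fun z l => φ l (z l)) id := by
  intro n
  induction n with
  | zero =>
    intro φ c _ _
    have : (fun (z : Fin 0 → E) l => φ l (z l)) = id := by
      funext z l; exact l.elim0
    rw [this, Finset.univ_eq_empty, Finset.sum_empty]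
    exact refl hq measurable_id
  | succ n ih =>
    intro φ c hφ H
    have ih' := ih (φ := fun l => φ l.succ) (c := fun l => c l.succ) (fun l => hφ _) fun l => H _
    have hmφ : Measurable fun (z : Fin n → E) l => φ (Fin.succ l) (z l) :=
      measurable_pi_lambda _ fun l => (hφ _).comp (measurable_pi_apply l)
    have hp := (H 0).prod (zero_lt_one.trans hq) (ν := Measure.pi fun _ : Fin n => γ)
      (φ' := fun _ z l => φ (Fin.succ l) (z l)) (ψ' := fun _ z => z) (hφ 0) measurable_id
      (hmφ.comp measurable_snd) measurable_snd (fun _ => ih')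
    have hmp := measurePreserving_piFinSuccAbove (fun _ : Fin (n + 1) => γ) 0
    have he := (MeasurableEquiv.piFinSuccAbove (fun _ : Fin (n + 1) => E) 0).symm.measurable
    have := (hp.postcomp he).precomp hmp
      (he.comp (((hφ 0).comp measurable_fst).prodMk (hmφ.comp measurable_snd)))
      (he.comp (measurable_fst.prodMk measurable_snd))
    rw [Fin.sum_univ_succ]
    convert this using 1
    · funext z l
      refine Fin.cases ?_ (fun l => ?_) l <;> simp [MeasurableEquiv.piFinSuccAbove, Fin.tail]
    · funext z l
      refine Fin.cases ?_ (fun l => ?_) l <;> simp [MeasurableEquiv.piFinSuccAbove, Fin.tail]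

/-- Conversion of Hölder domination to approximate differential privacy. -/
theorem measure_le [IsProbabilityMeasure μ] (hq : 1 < q) {δ ε : ℝ} (hδ : 0 < δ)
    (hε : (q - 1) * Real.log (1 / δ) + q * c ≤ ε) (hφ : Measurable φ) (hψ : Measurable ψ)
    (H : HolderDom q c μ φ ψ) {S : Set X} (hS : MeasurableSet S) :
    μ (φ ⁻¹' S) ≤ ENNReal.ofReal (Real.exp ε) * μ (ψ ⁻¹' S) + ENNReal.ofReal δ := by
  have hq0 : 0 < q := by linarith
  have h1 := H (S.indicator 1) (measurable_one.indicator hS)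
  have e1 : ∫⁻ ω, S.indicator (1 : X → ℝ≥0∞) (φ ω) ∂μ = μ (φ ⁻¹' S) := by
    rw [← lintegral_indicator_one (hφ hS)]; rfl
  have e2 : ∫⁻ ω, S.indicator (1 : X → ℝ≥0∞) (ψ ω) ^ q ∂μ = μ (ψ ⁻¹' S) := by
    rw [← lintegral_indicator_one (hψ hS)]
    congr 1; funext ω
    by_cases hω : ψ ω ∈ S
    · simp [hω]
    · simp [hω, hq0]
  rw [e1, e2] at h1
  refine h1.trans ?_
  set Q := (μ (ψ ⁻¹' S)).toReal with hQ
  have hQe : μ (ψ ⁻¹' S) = ENNReal.ofReal Q := (ENNReal.ofReal_toReal (measure_ne_top _ _)).symm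
  have hQ0 : 0 ≤ Q := ENNReal.toReal_nonneg
  rw [hQe, ENNReal.ofReal_rpow_of_nonneg hQ0 (by positivity), ← ENNReal.ofReal_mul (by positivity),
    ← ENNReal.ofReal_mul (by positivity), ← ENNReal.ofReal_add (by positivity) hδ.le]
  apply ENNReal.ofReal_le_ofReal
  -- In this case δ alone suffices. Otherwise Q > (δ e^(-c))^q, and this lower bound turns Q^(1/q)
  -- into a multiple of Q.
  by_cases hle : Real.exp c * Q ^ (1 / q) ≤ δ
  · have : 0 ≤ Real.exp ε * Q := by positivity
    linarith
  push Not at hle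
  have hQpos : 0 < Q := by
    rcases hQ0.eq_or_lt with h | h
    · rw [← h, Real.zero_rpow (by positivity)] at hle; linarith
    · exact h
  suffices Real.exp c * Q ^ (1 / q) ≤ Real.exp ε * Q by linarith
  have hlog : Real.log δ ≤ c + 1 / q * Real.log Q := by
    have := Real.log_le_log hδ hle.le
    rwa [Real.log_mul (Real.exp_ne_zero _) (by positivity), Real.log_exp,
      Real.log_rpow hQpos] at this
  have e3 : Q ^ (1 / q) = Real.exp (1 / q * Real.log Q) := by
    rw [Real.rpow_def_of_pos hQpos, mul_comm]
  nth_rewrite 2 [← Real.exp_log hQpos]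
  rw [e3, ← Real.exp_add, ← Real.exp_add, Real.exp_le_exp]
  rw [one_div δ, Real.log_inv] at hε
  have h4 : q * Real.log δ ≤ q * c + Real.log Q := by
    have := mul_le_mul_of_nonneg_left hlog hq0.le
    calc _ ≤ _ := this
      _ = _ := by field_simp
  have h5 : (q - 1) / q * (q * Real.log δ) ≤ (q - 1) / q * (q * c + Real.log Q) :=
    mul_le_mul_of_nonneg_left h4 (div_nonneg (by linarith) hq0.le)
  have h6 : (q - 1) / q * (q * Real.log δ) = (q - 1) * Real.log δ := by field_simp
  have h7 : (q - 1) / q * (q * c + Real.log Q)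
      = (q - 1) * c + Real.log Q - 1 / q * Real.log Q := by field_simp; ring
  linarith

end HolderDom

/-! ### Translated Gaussians. -/

/-- A translated Gaussian on the line. -/
theorem holderDom_gaussianReal {q : ℝ} (hq : 1 < q) (a : ℝ) :
    HolderDom q (a ^ 2 / (2 * (q - 1))) (gaussianReal 0 1) (fun x => x + a) id := by
  intro h hh
  have hpq := Real.HolderConjugate.conjExponent hq
  set p := Real.conjExponent q with hp
  have hppos : 0 < p := hpq.symm.pos
  -- The factor `exp (a * x - a ^ 2 / 2)` is the likelihood ratio of N(a, 1) to N(0, 1). After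
  -- Hölder only its p-th moment matters, and p - 1 = 1 / (q - 1).
  have e1 : ∫⁻ x, h (x + a) ∂gaussianReal 0 1
      = ∫⁻ x, h x * ENNReal.ofReal (Real.exp (a * x - a ^ 2 / 2)) ∂gaussianReal 0 1 := by
    have := lintegral_map (μ := gaussianReal 0 1) hh (measurable_add_const a)
    rw [← this, gaussianReal_map_add_const, gaussianReal_of_var_ne_zero _ one_ne_zero,
      gaussianReal_of_var_ne_zero _ one_ne_zero,
      lintegral_withDensity_eq_lintegral_mul _ (measurable_gaussianPDF _ _) hh,
      lintegral_withDensity_eq_lintegral_mul _ (measurable_gaussianPDF _ _)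
        (g := fun x => h x * ENNReal.ofReal (Real.exp (a * x - a ^ 2 / 2)))
        (hh.mul (by fun_prop))]
    congr 1; funext x
    simp only [Pi.mul_apply, gaussianPDF]
    rw [mul_left_comm, ← ENNReal.ofReal_mul (gaussianPDFReal_nonneg _ _ _), mul_comm]
    congr 2
    simp only [gaussianPDFReal, NNReal.coe_one]
    rw [mul_assoc (_)⁻¹ (Real.exp _), ← Real.exp_add]
    congr 2
    ring
  have e2 : ∫⁻ x, ENNReal.ofReal (Real.exp (a * x - a ^ 2 / 2)) ^ p ∂gaussianReal 0 1
      = ENNReal.ofReal (Real.exp (p * (p - 1) * a ^ 2 / 2)) := by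
    have : ∀ x, ENNReal.ofReal (Real.exp (a * x - a ^ 2 / 2)) ^ p
        = ENNReal.ofReal (Real.exp (-(p * a ^ 2 / 2)) * Real.exp (p * a * x)) := by
      intro x
      rw [ENNReal.ofReal_rpow_of_nonneg (Real.exp_nonneg _) hppos.le, ← Real.exp_mul,
        ← Real.exp_add]
      congr 2; ring
    simp_rw [this]
    rw [← ofReal_integral_eq_lintegral_ofReal ((integrable_exp_mul_gaussianReal _).const_mul _)
      (Filter.Eventually.of_forall fun x => by positivity), integral_const_mul]
    have hm := congrFun (mgf_fun_id_gaussianReal (μ := 0) (v := 1)) (p * a)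
    rw [mgf] at hm
    rw [hm, ← Real.exp_add]
    congr 2
    simp only [NNReal.coe_one]; ring
  rw [e1]
  refine (ENNReal.lintegral_mul_le_Lp_mul_Lq _ hpq hh.aemeasurable (by fun_prop)).trans ?_
  rw [e2, mul_comm, ENNReal.ofReal_rpow_of_nonneg (Real.exp_nonneg _) (by positivity),
    ← Real.exp_mul]
  refine le_of_eq ?_
  simp only [id_eq]
  congr 3
  have : p - 1 = 1 / (q - 1) := by
    rw [hp, Real.conjExponent]; have : q - 1 ≠ 0 := by linarith
    field_simp; ring
  rw [this]; have : q - 1 ≠ 0 := by linarith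
  field_simp

/-- A translated standard Gaussian on `ℝ^d`. -/
theorem holderDom_stdGaussian {d : ℕ} {q : ℝ} (hq : 1 < q) (v : Space d) :
    HolderDom q (‖v‖ ^ 2 / (2 * (q - 1))) (stdGaussian (Space d)) (fun x => x + v) id := by
  have h := HolderDom.pi hq (fun l => measurable_add_const (v l))
    (fun l => holderDom_gaussianReal hq (v l))
  have hm : Measurable (WithLp.toLp 2 : (Fin d → ℝ) → Space d) := by fun_prop
  have := h.postcomp hm
  rw [← Finset.sum_div, ← EuclideanSpace.real_norm_sq_eq] at this
  intro f hf
  rw [← map_pi_eq_stdGaussian, lintegral_map (by fun_prop) (by fun_prop),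
    lintegral_map (by fun_prop) (by fun_prop)]
  exact this f hf

/-! ### Projection, continuity and the recursion of the iterates. -/

variable {d N K : ℕ} {C : Set (Space d)}

instance isProbabilityMeasure_noiseLaw : IsProbabilityMeasure (noiseLaw d N K) := by
  unfold noiseLaw; infer_instance

theorem proj_spec (hne : C.Nonempty) (hcl : IsClosed C) (x : Space d) :
    proj C x ∈ C ∧ dist x (proj C x) = Metric.infDist x C := by
  have h : ∃ p ∈ C, dist x p = Metric.infDist x C := by
    obtain ⟨p, hp, h⟩ := hcl.exists_infDist_eq_dist hne x
    exact ⟨p, hp, h.symm⟩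
  rw [proj, dif_pos h]
  exact h.choose_spec

theorem proj_mem (hne : C.Nonempty) (hcl : IsClosed C) (x : Space d) : proj C x ∈ C :=
  (proj_spec hne hcl x).1

theorem inner_sub_proj_le_zero (hne : C.Nonempty) (hcl : IsClosed C) (hcv : Convex ℝ C)
    (x : Space d) {y : Space d} (hy : y ∈ C) :
    inner ℝ (x - proj C x) (y - proj C x) ≤ 0 := by
  obtain ⟨hm, hd⟩ := proj_spec hne hcl x
  refine (norm_eq_iInf_iff_real_inner_le_zero hcv hm).1 ?_ y hy
  rw [← dist_eq_norm, hd, Metric.infDist_eq_iInf]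
  simp_rw [dist_eq_norm]

theorem norm_proj_sub_proj_le (hne : C.Nonempty) (hcl : IsClosed C) (hcv : Convex ℝ C)
    (x y : Space d) : ‖proj C x - proj C y‖ ≤ ‖x - y‖ := by
  have h1 := inner_sub_proj_le_zero hne hcl hcv x (proj_mem hne hcl y)
  have h2 := inner_sub_proj_le_zero hne hcl hcv y (proj_mem hne hcl x)
  set a := proj C x
  set b := proj C y
  have h3 : ‖a - b‖ * ‖a - b‖ ≤ inner ℝ (x - y) (a - b) := by
    rw [← real_inner_self_eq_norm_mul_norm]
    have : inner ℝ (x - y) (a - b) - inner ℝ (a - b) (a - b)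
        = -(inner ℝ (x - a) (b - a) + inner ℝ (y - b) (a - b)) := by
      rw [← inner_sub_left, ← neg_sub a b, inner_neg_right, neg_add, neg_neg, ← sub_eq_add_neg,
        ← inner_sub_left]
      congr 1; abel
    linarith
  have h4 := h3.trans (real_inner_le_norm _ _)
  by_contra! hlt
  nlinarith [norm_nonneg (x - y)]

theorem continuous_proj (hne : C.Nonempty) (hcl : IsClosed C) (hcv : Convex ℝ C) :
    Continuous (proj C) :=
  (LipschitzWith.of_dist_le_mul (K := 1) fun x y => by
    simpa [dist_eq_norm] using norm_proj_sub_proj_le hne hcl hcv x y).continuous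

theorem aggregate_mem (hne : C.Nonempty) (hcl : IsClosed C) (x : Fin N → Space d) :
    aggregate C x ∈ C := proj_mem hne hcl _

theorem continuous_aggregate (hne : C.Nonempty) (hcl : IsClosed C) (hcv : Convex ℝ C) :
    Continuous (aggregate C : (Fin N → Space d) → Space d) :=
  (continuous_proj hne hcl hcv).comp (by fun_prop)

theorem l1Norm_nonneg (v : Space d) : 0 ≤ l1Norm v := Finset.sum_nonneg fun _ _ => abs_nonneg _

theorem norm_le_l1Norm (v : Space d) : ‖v‖ ≤ l1Norm v := by
  rw [← sq_le_sq₀ (norm_nonneg _) (l1Norm_nonneg v), EuclideanSpace.real_norm_sq_eq, l1Norm]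
  simpa using Finset.sum_sq_le_sq_sum_of_nonneg (s := Finset.univ) (f := fun l => |v l|)
    fun _ _ => abs_nonneg _

theorem LossFunction.IsSmooth.continuousOn_grad {f : LossFunction C} {M : ℝ}
    (hf : f.IsSmooth M) : ContinuousOn f.grad C := by
  have : LipschitzOnWith M.toNNReal f.grad C := by
    refine LipschitzOnWith.of_dist_le_mul fun x hx y hy => ?_
    rw [dist_eq_norm, dist_eq_norm]
    exact (hf x hx y hy).trans
      (mul_le_mul_of_nonneg_right (Real.le_coe_toNNReal M) (norm_nonneg _))
  exact this.continuousOn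

/-- One round of noisy decentralized gradient descent. -/
noncomputable def step (f : Fin N → LossFunction C) (η σ : ℝ) (s z : Fin N → Space d) :
    Fin N → Space d :=
  fun i => aggregate C s - η • (f i).grad (aggregate C s) + σ • z i

theorem continuous_step {f : Fin N → LossFunction C} {η σ : ℝ} (hne : C.Nonempty)
    (hcl : IsClosed C) (hcv : Convex ℝ C) (hf : ∀ i, ContinuousOn (f i).grad C) :
    Continuous (Function.uncurry (step f η σ)) := by
  have ha := continuous_aggregate (N := N) hne hcl hcv
  have hg : ∀ i, Continuous fun s : Fin N → Space d => (f i).grad (aggregate C s) := fun i =>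
    (hf i).comp_continuous ha fun s => aggregate_mem hne hcl s
  refine continuous_pi fun i => ?_
  have h1 : Continuous fun a : (Fin N → Space d) × (Fin N → Space d) => aggregate C a.1 :=
    ha.comp continuous_fst
  have h2 : Continuous fun a : (Fin N → Space d) × (Fin N → Space d) =>
      (f i).grad (aggregate C a.1) := (hg i).comp continuous_fst
  have h3 : Continuous fun a : (Fin N → Space d) × (Fin N → Space d) => a.2 i :=
    (continuous_apply i).comp continuous_snd
  exact (h1.sub (h2.const_smul η)).add (h3.const_smul σ)

theorem iterate_succ (f : Fin N → LossFunction C) (η σ : ℝ) (s : Fin N → Space d)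
    (Z : ℕ → Fin N → Space d) (k : ℕ) :
    iterate f η σ s Z (k + 1) = step f η σ (iterate f η σ s Z k) (Z k) := rfl

/-- Peeling off the first round instead of the last is what the induction on the number of rounds in
`holderDom_transcript` requires. -/
theorem iterate_succ' (f : Fin N → LossFunction C) (η σ : ℝ) (s : Fin N → Space d)
    (Z : ℕ → Fin N → Space d) (k : ℕ) :
    iterate f η σ s Z (k + 1)
      = iterate f η σ (step f η σ s (Z 0)) (fun j => Z (j + 1)) k := by
  induction k with
  | zero => rfl
  | succ k ih => rw [iterate_succ, ih, iterate_succ]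

theorem continuous_extend (k : ℕ) : Continuous fun ω : Noise d N K => ω.extend k := by
  unfold Noise.extend
  split_ifs
  · exact continuous_apply _
  · exact continuous_const

theorem continuous_iterate {f : Fin N → LossFunction C} {η σ : ℝ} (hne : C.Nonempty)
    (hcl : IsClosed C) (hcv : Convex ℝ C) (hf : ∀ i, ContinuousOn (f i).grad C) (k : ℕ) :
    Continuous fun a : (Fin N → Space d) × Noise d N K => iterate f η σ a.1 a.2.extend k := by
  induction k with
  | zero => exact continuous_fst
  | succ k ih =>
    have h2 : Continuous fun a : (Fin N → Space d) × Noise d N K => a.2.extend k :=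
      (continuous_extend k).comp continuous_snd
    have h3 := (continuous_step (η := η) (σ := σ) hne hcl hcv hf).comp (ih.prodMk h2)
    simpa only [iterate_succ, Function.comp_def, Function.uncurry_apply_pair] using h3

theorem continuous_transcript {f : Fin N → LossFunction C} {η σ : ℝ} (hne : C.Nonempty)
    (hcl : IsClosed C) (hcv : Convex ℝ C) (hf : ∀ i, ContinuousOn (f i).grad C) :
    Continuous (Function.uncurry (transcript (K := K) f η σ)) :=
  continuous_pi fun k => continuous_iterate hne hcl hcv hf k

theorem transcript_succ (f : Fin N → LossFunction C) (η σ : ℝ) (s : Fin N → Space d)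
    (ω : Noise d N (K + 1)) :
    transcript f η σ s ω = Fin.cons (α := fun _ => Fin N → Space d) s
      (transcript (K := K) f η σ (step f η σ s (ω 0)) fun k => ω k.succ) := by
  funext k
  refine Fin.cases rfl (fun k => ?_) k
  rw [Fin.cons_succ]
  simp only [transcript, Fin.val_succ]
  rw [iterate_succ']
  congr 1
  · funext j
    simp [Noise.extend]

/-! ### Privacy of the transcript. -/

/-- The change of gradient is absorbed into the noise as a translation by `v`. Only coordinate `i`
is translated, so the number of agents does not enter the cost. -/
theorem holderDom_step {f g : Fin N → LossFunction C} {η σ q B : ℝ} (hq : 1 < q) (hσ : 0 < σ)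
    (s : Fin N → Space d) {i : Fin N} (hfg : ∀ j, j ≠ i → f j = g j)
    (hB : ‖(f i).grad (aggregate C s) - (g i).grad (aggregate C s)‖ ≤ B) :
    HolderDom q ((η * B / σ) ^ 2 / (2 * (q - 1)))
      (Measure.pi fun _ : Fin N => stdGaussian (Space d)) (step f η σ s) (step g η σ s) := by
  set x := aggregate C s with hx
  set v : Fin N → Space d := fun j => (η / σ) • ((g j).grad x - (f j).grad x) with hv
  have h := HolderDom.pi hq (fun j => measurable_add_const (v j))
    (fun j => holderDom_stdGaussian hq (v j))
  have he : Measurable fun (z : Fin N → Space d) j => x - η • (g j).grad x + σ • z j := by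
    fun_prop
  have h' := h.postcomp he
  have hc : ∑ j, ‖v j‖ ^ 2 / (2 * (q - 1)) ≤ (η * B / σ) ^ 2 / (2 * (q - 1)) := by
    rw [Finset.sum_eq_single i]
    · have : 0 ≤ 2 * (q - 1) := by linarith
      gcongr ?_ / _
      rw [hv]
      simp only [norm_smul, Real.norm_eq_abs]
      rw [mul_pow, sq_abs, norm_sub_rev, mul_div_right_comm, mul_pow]
      gcongr
    · intro j _ hj
      simp [hv, hfg j hj]
    · simp
  refine HolderDom.mono hc ?_
  convert h' using 1
  · funext z j
    simp only [step, ← hx, hv, smul_add, smul_smul, smul_sub, mul_div_cancel₀ η hσ.ne']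
    abel
  · rfl

/-- Adaptive composition over the rounds. The induction is uniform in `s` because the remaining
rounds start from the random outcome of the first. -/
theorem holderDom_transcript {f g : Fin N → LossFunction C} {η σ q B : ℝ} (hq : 1 < q)
    (hσ : 0 < σ) (hne : C.Nonempty) (hcl : IsClosed C) (hcv : Convex ℝ C)
    (hf : ∀ i, ContinuousOn (f i).grad C) (hg : ∀ i, ContinuousOn (g i).grad C)
    {i : Fin N} (hfg : ∀ j, j ≠ i → f j = g j)
    (hB : ∀ x ∈ C, ‖(f i).grad x - (g i).grad x‖ ≤ B) (s : Fin N → Space d) :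
    HolderDom q (K * ((η * B / σ) ^ 2 / (2 * (q - 1)))) (noiseLaw d N K)
      (transcript f η σ s) (transcript g η σ s) := by
  induction K generalizing s with
  | zero =>
    have : ∀ f : Fin N → LossFunction C, transcript (K := 0) f η σ s = fun _ _ => s := by
      intro f; funext ω k
      have : k = 0 := Fin.fin_one_eq_zero k
      subst this; rfl
    rw [this, this, Nat.cast_zero, zero_mul]
    exact HolderDom.refl hq measurable_const
  | succ K ih =>
    have hms : ∀ {f : Fin N → LossFunction C}, (∀ i, ContinuousOn (f i).grad C) →
        Measurable (step f η σ s) := fun h =>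
      ((continuous_step hne hcl hcv h).comp (Continuous.prodMk_right s)).measurable
    have hmt : ∀ {f : Fin N → LossFunction C}, (∀ i, ContinuousOn (f i).grad C) →
        Measurable (Function.uncurry (transcript (K := K) f η σ)) := fun h =>
      (continuous_transcript hne hcl hcv h).measurable
    have hp := (holderDom_step (η := η) hq hσ s hfg (hB _ (aggregate_mem hne hcl s))).prod
      (zero_lt_one.trans hq) (hms hf) (hms hg) (hmt hf) (hmt hg) ih
    -- The second component already begins with the state after the first round, so prepending `s`
    -- to it gives the whole transcript and the first component can be dropped.
    have he : Measurable fun y : (Fin N → Space d) × (Fin (K + 1) → Fin N → Space d) =>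
        Fin.cons (α := fun _ : Fin (K + 2) => Fin N → Space d) s y.2 := by
      refine measurable_pi_lambda _ fun k => ?_
      refine Fin.cases ?_ (fun k => ?_) k
      · simp
      · simp only [Fin.cons_succ]; fun_prop
    have hmp := measurePreserving_piFinSuccAbove
      (fun _ : Fin (K + 1) => Measure.pi fun _ : Fin N => stdGaussian (Space d)) 0
    have hpm : ∀ {f : Fin N → LossFunction C}, (∀ i, ContinuousOn (f i).grad C) →
        Measurable fun ω : (Fin N → Space d) × Noise d N K =>
          (step f η σ s ω.1, transcript f η σ (step f η σ s ω.1) ω.2) := by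
      intro f h
      have h1 : Measurable fun ω : (Fin N → Space d) × Noise d N K => step f η σ s ω.1 :=
        (hms h).comp measurable_fst
      have h2 := (hmt h).comp (h1.prodMk measurable_snd)
      exact h1.prodMk h2
    have := (hp.postcomp he).precomp hmp (he.comp (hpm hf)) (he.comp (hpm hg))
    have hcst : ((K + 1 : ℕ) : ℝ) * ((η * B / σ) ^ 2 / (2 * (q - 1)))
        = (η * B / σ) ^ 2 / (2 * (q - 1)) + K * ((η * B / σ) ^ 2 / (2 * (q - 1))) := by
      push_cast; ring
    rw [hcst]
    convert this using 1
    · rfl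
    · funext ω; exact transcript_succ f η σ s ω
    · funext ω; exact transcript_succ g η σ s ω

/-- Noisy decentralized gradient descent is locally differentially private when the noise level is
large enough. -/
theorem isLDP_transcript {F : Fin N → Set (LossFunction C)} {M B η σ ε δ : ℝ} (hne : C.Nonempty)
    (hcl : IsClosed C) (hcv : Convex ℝ C) (hsm : ∀ i, ∀ f ∈ F i, f.IsSmooth M)
    (hB : ∀ i, HasSensitivity (F i) B) (hσ : 0 < σ) (hδ : 0 < δ) (hδ' : δ < 1)
    (hε : 0 < ε) (hεδ : ε ≤ 1 + Real.log (1 / δ))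
    (hσK : 3 * (1 + Real.log (1 / δ)) * K * (η * B) ^ 2 ≤ (ε * σ) ^ 2)
    (x0 : Fin N → Space d) :
    IsLDP F (noiseLaw d N K) (fun f => transcript f η σ x0) ε δ := by
  intro f g hf hg i hfg S hS
  have hcf : ∀ j, ContinuousOn (f j).grad C := fun j => (hsm j _ (hf j)).continuousOn_grad
  have hcg : ∀ j, ContinuousOn (g j).grad C := fun j => (hsm j _ (hg j)).continuousOn_grad
  have hlog : 0 < Real.log (1 / δ) := Real.log_pos (by rw [lt_div_iff₀ hδ]; linarith)
  set ℓ := 1 + Real.log (1 / δ) with hℓ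
  have hℓ0 : 0 < ℓ := by linarith
  -- This choice gives half of ε to the term with log(1/δ). Since ε ≤ ℓ also gives q ≤ 3/2, a
  -- composition cost of ε/3 fits into the other half.
  set q := 1 + ε / (2 * ℓ) with hq
  have hq1 : 1 < q := by have : 0 < ε / (2 * ℓ) := by positivity
                         linarith
  have hq2 : q ≤ 3 / 2 := by
    have : ε / (2 * ℓ) ≤ 1 / 2 := by rw [div_le_iff₀ (by positivity)]; linarith
    linarith
  have hm : ∀ {f : Fin N → LossFunction C}, (∀ i, ContinuousOn (f i).grad C) →
      Measurable (transcript (K := K) f η σ x0) := fun h =>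
    ((continuous_transcript hne hcl hcv h).comp (Continuous.prodMk_right x0)).measurable
  refine (holderDom_transcript hq1 hσ hne hcl hcv hcf hcg hfg (fun x hx =>
    (norm_le_l1Norm _).trans (hB i _ (hf i) _ (hg i) x hx)) x0).measure_le hq1 hδ ?_
    (hm hcf) (hm hcg) hS
  have h1 : (q - 1) * Real.log (1 / δ) ≤ ε / 2 := by
    have : q - 1 = ε / (2 * ℓ) := by rw [hq]; ring
    rw [this, div_mul_eq_mul_div, div_le_iff₀ (by positivity)]
    nlinarith
  have h2 : q * (K * ((η * B / σ) ^ 2 / (2 * (q - 1)))) ≤ ε / 2 := by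
    have e : q - 1 = ε / (2 * ℓ) := by rw [hq]; ring
    have h3 : (K : ℝ) * ((η * B / σ) ^ 2 / (2 * (q - 1))) ≤ ε / 3 := by
      rw [e]
      have : (K : ℝ) * ((η * B / σ) ^ 2 / (2 * (ε / (2 * ℓ))))
          = (3 * ℓ * K * (η * B) ^ 2) / (3 * ε * σ ^ 2) := by field_simp
      rw [this, div_le_iff₀ (by positivity)]
      refine hσK.trans (le_of_eq ?_); ring
    nlinarith
  linarith

/-! ### Convexity inequalities and the perturbed projected step. -/

namespace LossFunction

variable {f : LossFunction C} {m M C₁ : ℝ} {x y : Space d}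

theorem hasDerivWithinAt_segment (f : LossFunction C) (hcv : Convex ℝ C) (hx : x ∈ C) (hy : y ∈ C)
    {t : ℝ} (ht : t ∈ Set.Icc (0 : ℝ) 1) :
    HasDerivWithinAt (fun t : ℝ => f.val (x + t • (y - x)))
      (inner ℝ (f.grad (x + t • (y - x))) (y - x)) (Set.Icc 0 1) t := by
  have hmap : Set.MapsTo (fun t : ℝ => x + t • (y - x)) (Set.Icc 0 1) C :=
    fun s hs => hcv.add_smul_sub_mem hx hy hs
  have h1 : HasDerivWithinAt (fun t : ℝ => x + t • (y - x)) (y - x) (Set.Icc 0 1) t := by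
    simpa using (((hasDerivAt_id t).smul_const (y - x)).const_add x).hasDerivWithinAt
  have h2 := (f.hasGradient _ (hmap ht)).hasFDerivWithinAt.comp_hasDerivWithinAt t h1 hmap
  simpa [Function.comp_def] using h2

/-- The function t⟨∇f(x), y - x⟩ + (c/2) t² - f(x + t(y - x)) is monotone on [0, 1]. Only
derivatives within the segment are used, so `C` may have empty interior. -/
theorem val_sub_le_of_inner_le (f : LossFunction C) (hcv : Convex ℝ C) (hx : x ∈ C) (hy : y ∈ C)
    {c : ℝ} (h : ∀ t ∈ Set.Ioo (0 : ℝ) 1,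
      inner ℝ (f.grad (x + t • (y - x)) - f.grad x) (y - x) ≤ c * t) :
    f.val y ≤ f.val x + inner ℝ (f.grad x) (y - x) + c / 2 := by
  have hd : ∀ t ∈ Set.Icc (0 : ℝ) 1, HasDerivWithinAt
      (fun t : ℝ => t * inner ℝ (f.grad x) (y - x) + c / 2 * t ^ 2 - f.val (x + t • (y - x)))
      (inner ℝ (f.grad x) (y - x) + c * t - inner ℝ (f.grad (x + t • (y - x))) (y - x))
      (Set.Icc 0 1) t := by
    intro t ht
    refine HasDerivWithinAt.sub ?_ (f.hasDerivWithinAt_segment hcv hx hy ht)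
    refine HasDerivAt.hasDerivWithinAt ?_
    convert! ((hasDerivAt_id t).mul_const (inner ℝ (f.grad x) (y - x))).add
      ((hasDerivAt_pow 2 t).const_mul (c / 2)) using 1
    simp; ring
  have hmono := monotoneOn_of_hasDerivWithinAt_nonneg (convex_Icc (0 : ℝ) 1)
    (fun t ht => (hd t ht).continuousWithinAt)
    (fun t ht => (hd t (interior_subset ht)).mono interior_subset)
    (fun t ht => by
      rw [interior_Icc] at ht
      have := h t ht
      rw [inner_sub_left] at this
      linarith)
  have := hmono (Set.left_mem_Icc.2 zero_le_one) (Set.right_mem_Icc.2 zero_le_one) zero_le_one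
  simp at this
  linarith

theorem le_val_sub_of_le_inner (f : LossFunction C) (hcv : Convex ℝ C) (hx : x ∈ C) (hy : y ∈ C)
    {c : ℝ} (h : ∀ t ∈ Set.Ioo (0 : ℝ) 1,
      c * t ≤ inner ℝ (f.grad (x + t • (y - x)) - f.grad x) (y - x)) :
    f.val x + inner ℝ (f.grad x) (y - x) + c / 2 ≤ f.val y := by
  have hneg : ∀ z ∈ C, HasGradientWithinAt (fun z => -f.val z) (-f.grad z) C z := by
    intro z hz
    have := (f.hasGradient z hz).hasFDerivWithinAt.neg
    rw [← map_neg] at this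
    exact hasGradientWithinAt_iff_hasFDerivWithinAt.2 this
  have := val_sub_le_of_inner_le (⟨fun z => -f.val z, fun z => -f.grad z, hneg⟩ : LossFunction C)
    hcv hx hy (c := -c) fun t ht => by
      have := h t ht
      rw [← neg_sub', inner_neg_left]
      linarith
  simp only [inner_neg_left] at this
  linarith

theorem IsSmooth.val_le (hf : f.IsSmooth M) (hcv : Convex ℝ C) (hx : x ∈ C) (hy : y ∈ C) :
    f.val y ≤ f.val x + inner ℝ (f.grad x) (y - x) + M / 2 * ‖y - x‖ ^ 2 := by
  rw [div_mul_eq_mul_div]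
  refine f.val_sub_le_of_inner_le hcv hx hy fun t ht => ?_
  have hz := hcv.add_smul_sub_mem hx hy ⟨ht.1.le, ht.2.le⟩
  have h1 := hf _ hz x hx
  rw [add_sub_cancel_left, norm_smul, Real.norm_of_nonneg ht.1.le] at h1
  calc _ ≤ ‖f.grad (x + t • (y - x)) - f.grad x‖ * ‖y - x‖ := real_inner_le_norm _ _
    _ ≤ M * (t * ‖y - x‖) * ‖y - x‖ := by gcongr
    _ = M * ‖y - x‖ ^ 2 * t := by ring

theorem IsStronglyConvex.le_val (hf : f.IsStronglyConvex m) (hcv : Convex ℝ C) (hx : x ∈ C)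
    (hy : y ∈ C) :
    f.val x + inner ℝ (f.grad x) (y - x) + m / 2 * ‖y - x‖ ^ 2 ≤ f.val y := by
  rw [div_mul_eq_mul_div]
  refine f.le_val_sub_of_le_inner hcv hx hy fun t ht => ?_
  have hz := hcv.add_smul_sub_mem hx hy ⟨ht.1.le, ht.2.le⟩
  have h1 := hf _ hz x hx
  rw [add_sub_cancel_left, norm_smul, Real.norm_of_nonneg ht.1.le, real_inner_smul_left,
    real_inner_comm] at h1
  refine le_of_mul_le_mul_left ?_ ht.1
  calc _ = m * (t * ‖y - x‖) ^ 2 := by ring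
    _ ≤ _ := h1

/-- One step of projected gradient descent with step size `1 / M` and perturbation `ξ`. -/
theorem val_proj_sub_le (hcl : IsClosed C) (hcv : Convex ℝ C) (hM : 0 < M)
    (hsc : f.IsStronglyConvex m) (hsm : f.IsSmooth M) (hx : x ∈ C) (hy : y ∈ C)
    {ξ x' : Space d} (hx' : x' = proj C (x - M⁻¹ • f.grad x + ξ)) :
    f.val x' - f.val y ≤ M / 2 * ((1 - m / M) * ‖x - y‖ ^ 2 - ‖x' - y‖ ^ 2)
      + M * inner ℝ ξ (x' - y) := by
  have hmem : x' ∈ C := hx' ▸ proj_mem ⟨x, hx⟩ hcl _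
  -- Three inequalities are added: this one times M, smoothness from x to x', and strong convexity
  -- from x to y. The gradient terms cancel.
  have hp := inner_sub_proj_le_zero ⟨x, hx⟩ hcl hcv (x - M⁻¹ • f.grad x + ξ) hy
  rw [← hx'] at hp
  have h1 := hsm.val_le hcv hx hmem
  have h2 := hsc.le_val hcv hx hy
  set g := f.grad x with hg
  have e1 : inner ℝ (x - M⁻¹ • g + ξ - x') (y - x')
      = inner ℝ (x - x') (y - x') - M⁻¹ * inner ℝ g (y - x') + inner ℝ ξ (y - x') := by
    rw [← real_inner_smul_left, ← inner_sub_left, ← inner_add_left]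
    congr 1; abel
  have e2 : ‖x - y‖ ^ 2 = ‖x - x'‖ ^ 2 - 2 * inner ℝ (x - x') (y - x') + ‖x' - y‖ ^ 2 := by
    rw [norm_sub_rev x' y, ← norm_sub_sq_real]
    congr 2; abel
  have e3 : inner ℝ g (x' - x) = inner ℝ g (y - x) - inner ℝ g (y - x') := by
    rw [← inner_sub_right]; congr 1; abel
  have e4 : inner ℝ ξ (x' - y) = -inner ℝ ξ (y - x') := by
    rw [← inner_neg_right, neg_sub]
  have hp' : M * inner ℝ (x - x') (y - x') - inner ℝ g (y - x')
      + M * inner ℝ ξ (y - x') ≤ 0 := by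
    have := mul_nonpos_of_nonneg_of_nonpos hM.le hp
    rw [e1] at this
    have h3 : M * (M⁻¹ * inner ℝ g (y - x')) = inner ℝ g (y - x') := by
      rw [mul_inv_cancel_left₀ hM.ne']
    linarith
  have h5 : M / 2 * ((1 - m / M) * ‖x - y‖ ^ 2 - ‖x' - y‖ ^ 2)
      = M / 2 * (‖x - y‖ ^ 2 - ‖x' - y‖ ^ 2) - m / 2 * ‖x - y‖ ^ 2 := by
    field_simp
    ring
  rw [h5, e4]
  rw [norm_sub_rev x' x] at h1
  rw [norm_sub_rev y x] at h2
  have h6 : M / 2 * (‖x - y‖ ^ 2 - ‖x' - y‖ ^ 2)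
      = M / 2 * ‖x - x'‖ ^ 2 - M * inner ℝ (x - x') (y - x') := by rw [e2]; ring
  linarith

theorem norm_grad_sub_le (hf : f.GradBounded C₁) (hx : x ∈ C) (hy : y ∈ C) :
    ‖f.grad x - f.grad y‖ ≤ 2 * C₁ := by
  have h1 := (norm_le_l1Norm _).trans (hf x hx)
  have h2 := (norm_le_l1Norm _).trans (hf y hy)
  have := norm_sub_le (f.grad x) (f.grad y)
  linarith

/-- The inverse gradient map is Lipschitz; this transports nets of the l_1 ball to `C` and bounds
the diameter of `C`. -/
theorem IsStronglyConvex.norm_sub_le (hf : f.IsStronglyConvex m) (hm : 0 < m) (hx : x ∈ C)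
    (hy : y ∈ C) : ‖x - y‖ ≤ ‖f.grad x - f.grad y‖ / m := by
  rw [le_div_iff₀ hm]
  have h1 := (hf x hx y hy).trans (real_inner_le_norm _ _)
  rcases (norm_nonneg (x - y)).eq_or_lt with h | h
  · rw [← h, zero_mul]; positivity
  · refine le_of_mul_le_mul_left ?_ h
    calc _ = m * ‖x - y‖ ^ 2 := by ring
      _ ≤ _ := h1

theorem IsStronglyConvex.norm_sub_le_of_gradBounded (hf : f.IsStronglyConvex m) (hm : 0 < m)
    (hb : f.GradBounded C₁) (hx : x ∈ C) (hy : y ∈ C) : ‖x - y‖ ≤ 2 * C₁ / m :=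
  (hf.norm_sub_le hm hx hy).trans (by gcongr; exact norm_grad_sub_le hb hx hy)

theorem IsStronglyConvex.isCompact (hf : f.IsStronglyConvex m) (hm : 0 < m)
    (hb : f.GradBounded C₁) (hcl : IsClosed C) : IsCompact C := by
  refine Metric.isCompact_of_isClosed_isBounded hcl ?_
  rw [Metric.isBounded_iff]
  exact ⟨2 * C₁ / m, fun x hx y hy => by
    rw [dist_eq_norm]; exact hf.norm_sub_le_of_gradBounded hm hb hx hy⟩

theorem continuousOn_val (f : LossFunction C) : ContinuousOn f.val C :=
  fun x hx => (f.hasGradient x hx).hasFDerivWithinAt.continuousWithinAt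

/-- The average of the loss functions of all agents. -/
noncomputable def average (f : Fin N → LossFunction C) : LossFunction C where
  val x := (N : ℝ)⁻¹ * ∑ i, (f i).val x
  grad x := (N : ℝ)⁻¹ • ∑ i, (f i).grad x
  hasGradient x hx := by
    have h := (HasFDerivWithinAt.fun_sum (u := Finset.univ)
      fun i _ => ((f i).hasGradient x hx).hasFDerivWithinAt).const_mul (N : ℝ)⁻¹
    rw [← map_sum] at h
    rw [hasGradientWithinAt_iff_hasFDerivWithinAt]
    convert! h using 1
    ext z
    simp

theorem natCast_mul_average_val [NeZero N] (f : Fin N → LossFunction C) (x : Space d) :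
    N * (average f).val x = objective f x := by
  have : (N : ℝ) ≠ 0 := Nat.cast_ne_zero.2 (NeZero.ne N)
  simp [average, objective, mul_inv_cancel_left₀ this]

theorem average_grad_sub (f : Fin N → LossFunction C) (x y : Space d) :
    (average f).grad x - (average f).grad y = (N : ℝ)⁻¹ • ∑ i, ((f i).grad x - (f i).grad y) := by
  simp only [average]
  rw [← smul_sub, ← Finset.sum_sub_distrib]

theorem average_isStronglyConvex [NeZero N] {f : Fin N → LossFunction C}
    (hf : ∀ i, (f i).IsStronglyConvex m) : (average f).IsStronglyConvex m := by
  intro x hx y hy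
  have hN : (0 : ℝ) < N := Nat.cast_pos.2 (NeZero.pos N)
  rw [average_grad_sub, real_inner_smul_right, inner_sum, le_inv_mul_iff₀ hN]
  calc N * (m * ‖x - y‖ ^ 2) = ∑ _i : Fin N, m * ‖x - y‖ ^ 2 := by simp
    _ ≤ _ := Finset.sum_le_sum fun i _ => hf i x hx y hy

theorem average_isSmooth [NeZero N] {f : Fin N → LossFunction C}
    (hf : ∀ i, (f i).IsSmooth M) : (average f).IsSmooth M := by
  intro x hx y hy
  have hN : (0 : ℝ) < N := Nat.cast_pos.2 (NeZero.pos N)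
  rw [average_grad_sub, norm_smul, norm_inv, Real.norm_of_nonneg hN.le, inv_mul_le_iff₀ hN]
  calc _ ≤ ∑ i, ‖(f i).grad x - (f i).grad y‖ := norm_sum_le _ _
    _ ≤ ∑ _i : Fin N, M * ‖x - y‖ := Finset.sum_le_sum fun i _ => hf i x hx y hy
    _ = _ := by simp

end LossFunction

/-- All agents step from the same point, so averaging reduces the protocol to a single perturbed
projected descent on the average loss. -/
theorem aggregate_step [NeZero N] (f : Fin N → LossFunction C) (η σ : ℝ)
    (s z : Fin N → Space d) :
    aggregate C (step f η σ s z) = proj C (aggregate C s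
      - η • (LossFunction.average f).grad (aggregate C s) + (σ / N) • ∑ i, z i) := by
  have hN : (N : ℝ) ≠ 0 := Nat.cast_ne_zero.2 (NeZero.ne N)
  rw [aggregate]
  congr 1
  simp only [step, LossFunction.average, Finset.sum_add_distrib, Finset.sum_sub_distrib,
    ← Finset.smul_sum, smul_add, smul_sub, Finset.sum_const, Finset.card_univ, Fintype.card_fin,
    ← Nat.cast_smul_eq_nsmul ℝ, smul_smul, inv_mul_cancel₀ hN, one_smul]
  rw [mul_comm η, div_eq_inv_mul]

/-! ### Last-iterate bound for real sequences. -/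

/-- From averages over final segments to the last term. -/
theorem le_average_add_log {b : ℕ → ℝ} {V : ℝ} {n : ℕ} (hV : 0 ≤ V)
    (hb : ∀ k, 1 ≤ k → k < n → ∑ i ∈ Finset.range k, b i ≤ k * b k + k * V) :
    ∀ k, 1 ≤ k → k ≤ n → b 0 ≤ (∑ i ∈ Finset.range k, b i) / k + V * Real.log k := by
  intro k hk
  induction k, hk using Nat.le_induction with
  | base => intro _; simp
  | succ k hk ih =>
    intro hkn
    have hk0 : (0 : ℝ) < k := Nat.cast_pos.2 hk
    have h1 := ih (by omega)
    have h2 := hb k hk hkn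
    -- Lengthening the segment by one term costs V / (k + 1); these harmonic terms sum to a
    -- logarithm.
    have h3 : (∑ i ∈ Finset.range k, b i) / k
        ≤ (∑ i ∈ Finset.range (k + 1), b i) / (k + 1 : ℕ) + V / (k + 1) := by
      rw [Finset.sum_range_succ]
      push_cast
      rw [← add_div, div_le_div_iff₀ hk0 (by positivity)]
      nlinarith
    have h4 : V / (k + 1) ≤ V * (Real.log (k + 1 : ℕ) - Real.log k) := by
      rw [div_eq_mul_inv]
      refine mul_le_mul_of_nonneg_left ?_ hV
      rw [← Real.log_div (by positivity) hk0.ne']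
      refine le_trans (le_of_eq ?_) (Real.one_sub_inv_le_log_of_pos (by positivity))
      push_cast; field_simp; ring
    linarith

/-- The last-iterate bound for projected stochastic gradient descent with a constant step size, for
the sequence `a` of optimality gaps and the sequence `D` of squared distances to the minimizer. -/
theorem last_iterate_le {a D : ℕ → ℝ} {m M V R : ℝ} {n L : ℕ} (hm : 0 < m) (hM : 0 < M)
    (hmM : m ≤ M) (hV : 0 ≤ V) (hn : M / m ≤ n) (ha : ∀ k, 0 ≤ a k) (hD : ∀ k, 0 ≤ D k)
    (hD0 : D 0 ≤ R ^ 2)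
    (hstep : ∀ k < n * L + n, a (k + 1) ≤ M / 2 * ((1 - m / M) * D k - D (k + 1)) + V)
    (htail : ∀ k ≤ n * L + n,
      ∑ i ∈ Finset.range k, (a (n * L + n - i) - a (n * L + n - k)) ≤ k * V) :
    a (n * L + n) ≤ m / 2 * Real.exp (-L) * R ^ 2 + V * (2 + Real.log n) := by
  have hn0 : (0 : ℝ) < n := lt_of_lt_of_le (by positivity) hn
  have hn1 : 1 ≤ n := Nat.cast_pos.1 hn0
  set ρ := 1 - m / M with hρ
  have hmM' : m / M ≤ 1 := (div_le_one hM).2 hmM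
  have hρ0 : 0 ≤ ρ := by linarith
  have hρ1 : ρ ≤ 1 := by have : 0 < m / M := by positivity
                         linarith
  -- As a ≥ 0, `hstep` contracts D by ρ up to noise; `2 * V / m` is the fixed point of t ↦ ρ t +
  -- 2V/M.
  have hDk : ∀ k ≤ n * L + n, D k ≤ ρ ^ k * R ^ 2 + 2 * V / m := by
    intro k
    induction k with
    | zero => intro _; have : 0 ≤ 2 * V / m := by positivity
              simpa using by linarith
    | succ k ih =>
      intro hk
      have h1 := hstep k (by omega)
      have h2 := ih (by omega)
      have h3 : D (k + 1) ≤ ρ * D k + 2 * V / M := by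
        have h5 : 0 ≤ M / 2 * (ρ * D k - D (k + 1)) + V := (ha _).trans h1
        have h4 : 0 ≤ 2 / M * (M / 2 * (ρ * D k - D (k + 1)) + V) := by positivity
        have : 2 / M * (M / 2 * (ρ * D k - D (k + 1)) + V)
            = ρ * D k - D (k + 1) + 2 * V / M := by field_simp
        linarith
      have h4 : ρ * D k ≤ ρ * (ρ ^ k * R ^ 2 + 2 * V / m) := mul_le_mul_of_nonneg_left h2 hρ0
      have h5 : ρ * (ρ ^ k * R ^ 2 + 2 * V / m) + 2 * V / M = ρ ^ (k + 1) * R ^ 2 + 2 * V / m := by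
        have : ρ * (2 * V / m) + 2 * V / M = 2 * V / m := by rw [hρ]; field_simp; ring
        rw [pow_succ ρ]; linarith
      linarith
  -- A block of n ≥ M/m rounds gains a factor e.
  have hρL : ρ ^ (n * L) ≤ Real.exp (-L) := by
    have h1 : ρ ≤ Real.exp (-(m / M)) := by
      have := Real.add_one_le_exp (-(m / M)); linarith
    have h2 : ρ ^ n ≤ Real.exp (-1) := by
      refine (pow_le_pow_left₀ hρ0 h1 n).trans ?_
      rw [← Real.exp_nat_mul, Real.exp_le_exp]
      have : 1 ≤ n * (m / M) := by
        calc (1 : ℝ) = M / m * (m / M) := by field_simp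
          _ ≤ _ := by gcongr
      linarith
    rw [pow_mul]
    refine (pow_le_pow_left₀ (by positivity) h2 L).trans ?_
    rw [← Real.exp_nat_mul]; simp
  have hsum : ∀ k ≤ n, ∑ i ∈ Finset.range k, a (n * L + (i + 1))
      ≤ M / 2 * (D (n * L) - D (n * L + k)) + k * V := by
    intro k
    induction k with
    | zero => simp
    | succ k ih =>
      intro hk
      have h1 := hstep (n * L + k) (by omega)
      have h2 := ih (by omega)
      have h3 : ρ * D (n * L + k) ≤ D (n * L + k) := mul_le_of_le_one_left (hD _) hρ1
      rw [Finset.sum_range_succ]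
      push_cast
      have h4 : M / 2 * (ρ * D (n * L + k) - D (n * L + k + 1))
          ≤ M / 2 * (D (n * L + k) - D (n * L + k + 1)) := by gcongr
      rw [← add_assoc (n * L) k 1]
      linarith
  -- The last n rounds telescope. Since M ≤ n m, dividing by n lowers the prefactor M/2 of D(nL) to
  -- m/2.
  have hS : (∑ i ∈ Finset.range n, a (n * L + n - i)) / n
      ≤ m / 2 * Real.exp (-L) * R ^ 2 + 2 * V := by
    have h1 := hsum n le_rfl
    rw [← Finset.sum_range_reflect] at h1
    have h2 : ∑ j ∈ Finset.range n, a (n * L + (n - 1 - j + 1))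
        = ∑ i ∈ Finset.range n, a (n * L + n - i) := by
      refine Finset.sum_congr rfl fun i hi => ?_
      rw [Finset.mem_range] at hi
      congr 1; omega
    rw [h2] at h1
    rw [div_le_iff₀ hn0]
    have h3 : D (n * L) ≤ Real.exp (-L) * R ^ 2 + 2 * V / m :=
      (hDk _ (by omega)).trans (by gcongr)
    have h4 : M ≤ n * m := (div_le_iff₀ hm).1 hn
    have h5 : M / 2 * D (n * L) ≤ n * m / 2 * (Real.exp (-L) * R ^ 2 + 2 * V / m) :=
      (mul_le_mul_of_nonneg_right (by linarith) (hD _)).trans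
        (mul_le_mul_of_nonneg_left h3 (by positivity))
    have h6 : n * m / 2 * (Real.exp (-L) * R ^ 2 + 2 * V / m)
        = m / 2 * Real.exp (-L) * R ^ 2 * n + n * V := by field_simp
    have h7 : 0 ≤ M / 2 * D (n * L + n) := mul_nonneg (by positivity) (hD _)
    linarith
  have hlast := le_average_add_log (b := fun i => a (n * L + n - i)) (n := n) hV (fun k _ hkn => by
    have := htail k (by omega)
    rw [Finset.sum_sub_distrib] at this
    simp at this
    linarith) n hn1 le_rfl
  simp only [Nat.sub_zero] at hlast
  linarith

/-! ### Gaussian width of balls and finite sets. -/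

/-- The Gaussian width of `T` is at most `w`: the linear functionals `⟪z, x⟫`, `x ∈ T`, have a
common upper bound `Φ z` whose Gaussian expectation is at most `w`. -/
def HasWidthLE (T : Set (Space d)) (w : ℝ) : Prop :=
  ∃ Φ : Space d → ℝ, Integrable Φ (stdGaussian (Space d)) ∧ (∀ z, ∀ x ∈ T, inner ℝ z x ≤ Φ z) ∧
    ∫ z, Φ z ∂stdGaussian (Space d) ≤ w

namespace HasWidthLE

variable {S T U : Set (Space d)} {a b : ℝ}

theorem mono (h : HasWidthLE T a) (hST : S ⊆ T) (hab : a ≤ b) : HasWidthLE S b := by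
  obtain ⟨Φ, hi, hle, hint⟩ := h
  exact ⟨Φ, hi, fun z x hx => hle z x (hST hx), hint.trans hab⟩

theorem add (hS : HasWidthLE S a) (hT : HasWidthLE T b)
    (hU : ∀ x ∈ U, ∃ y ∈ S, ∃ z ∈ T, x = y + z) : HasWidthLE U (a + b) := by
  obtain ⟨Φ, hi, hle, hint⟩ := hS
  obtain ⟨Ψ, hi', hle', hint'⟩ := hT
  refine ⟨fun z => Φ z + Ψ z, hi.add hi', fun z x hx => ?_, ?_⟩
  · obtain ⟨y, hy, y', hy', rfl⟩ := hU x hx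
    rw [inner_add_right]
    exact add_le_add (hle z y hy) (hle' z y' hy')
  · rw [integral_add hi hi']; exact add_le_add hint hint'

end HasWidthLE

theorem map_inner_stdGaussian (v : Space d) :
    (stdGaussian (Space d)).map (fun z => inner ℝ z v) = gaussianReal 0 (‖v‖ ^ 2).toNNReal := by
  have h := IsGaussian.map_eq_gaussianReal (μ := stdGaussian (Space d)) (innerSL ℝ v)
  rw [variance_dual_stdGaussian, integral_strongDual_stdGaussian, innerSL_apply_norm] at h
  rw [← h]
  congr 1
  funext z
  simp [real_inner_comm]

theorem integrable_exp_inner (v : Space d) :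
    Integrable (fun z => Real.exp (inner ℝ z v)) (stdGaussian (Space d)) := by
  have h := integrable_exp_mul_gaussianReal (μ := 0) (v := (‖v‖ ^ 2).toNNReal) 1
  rw [← map_inner_stdGaussian] at h
  have := h.comp_measurable (by fun_prop)
  simpa [Function.comp_def] using this

theorem integral_exp_inner (v : Space d) :
    ∫ z, Real.exp (inner ℝ z v) ∂stdGaussian (Space d) = Real.exp (‖v‖ ^ 2 / 2) := by
  have h := mgf_gaussianReal (map_inner_stdGaussian v) 1
  rw [mgf] at h
  simpa [Real.coe_toNNReal _ (sq_nonneg ‖v‖)] using h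

theorem integrable_norm_sq_stdGaussian :
    Integrable (fun z => ‖z‖ ^ 2) (stdGaussian (Space d)) :=
  (IsGaussian.memLp_two_id (μ := stdGaussian (Space d))).integrable_norm_pow (by norm_num)

theorem integral_norm_sq_stdGaussian :
    ∫ z, ‖z‖ ^ 2 ∂stdGaussian (Space d) = d := by
  have h1 : ∀ l : Fin d, ∫ z : Space d, z l ^ 2 ∂stdGaussian (Space d) = 1 := by
    intro l
    have h := map_inner_stdGaussian (EuclideanSpace.single l (1 : ℝ))
    have hv := variance_id_gaussianReal (μ := 0) (v := 1)
    rw [variance_of_integral_eq_zero aemeasurable_id (by simp)] at hv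
    have h2 : (stdGaussian (Space d)).map (fun z => z l) = gaussianReal 0 1 := by
      simpa [EuclideanSpace.inner_single_right] using h
    rw [← h2, integral_map (by fun_prop) (by fun_prop)] at hv
    simpa using hv
  have h2 : ∀ l : Fin d, Integrable (fun z : Space d => z l ^ 2) (stdGaussian (Space d)) := by
    intro l
    refine integrable_norm_sq_stdGaussian.mono' (by fun_prop) (.of_forall fun z => ?_)
    rw [Real.norm_of_nonneg (sq_nonneg _), EuclideanSpace.real_norm_sq_eq]
    exact Finset.single_le_sum (f := fun l => z l ^ 2) (fun _ _ => sq_nonneg _) (Finset.mem_univ l)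
  simp_rw [EuclideanSpace.real_norm_sq_eq]
  rw [integral_finsetSum _ fun l _ => h2 l]
  simp [h1]

/-- By AM-GM, ‖z‖ is at most (‖z‖²/√d + √d)/2, whose expectation is exactly √d. -/
theorem hasWidthLE_closedBall (hd : 1 ≤ d) {r : ℝ} (hr : 0 ≤ r) :
    HasWidthLE (Metric.closedBall (0 : Space d) r) (r * Real.sqrt d) := by
  have hd0 : (0 : ℝ) < d := Nat.cast_pos.2 hd
  have hs : 0 < Real.sqrt d := Real.sqrt_pos.2 hd0
  refine ⟨fun z => r * ((‖z‖ ^ 2 / Real.sqrt d + Real.sqrt d) / 2), ?_, fun z x hx => ?_, ?_⟩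
  · exact (((integrable_norm_sq_stdGaussian.div_const _).add
      (integrable_const _)).div_const _).const_mul _
  · rw [mem_closedBall_zero_iff] at hx
    have h1 : ‖z‖ ≤ (‖z‖ ^ 2 / Real.sqrt d + Real.sqrt d) / 2 := by
      rw [le_div_iff₀ two_pos, div_add' _ _ _ hs.ne', le_div_iff₀ hs]
      nlinarith [sq_nonneg (‖z‖ - Real.sqrt d)]
    calc inner ℝ z x ≤ ‖z‖ * ‖x‖ := real_inner_le_norm _ _
      _ ≤ ‖z‖ * r := by gcongr
      _ = r * ‖z‖ := mul_comm _ _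
      _ ≤ _ := mul_le_mul_of_nonneg_left h1 hr
  · rw [integral_const_mul, integral_div, integral_add
      (integrable_norm_sq_stdGaussian.div_const _) (integrable_const _), integral_div,
      integral_norm_sq_stdGaussian]
    simp

/-- The maximal inequality for finitely many Gaussian variables. -/
theorem hasWidthLE_range {ι : Type*} [Fintype ι] [Nonempty ι] (v : ι → Space d) {r s : ℝ}
    (hr : 0 < r) (hs : 0 < s) (hcard : Real.log (Fintype.card ι) ≤ s) :
    HasWidthLE (Set.range v ∩ Metric.closedBall 0 r) (r * Real.sqrt (2 * s)) := by
  set t := Real.sqrt (2 * s) with ht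
  have ht0 : 0 < t := Real.sqrt_pos.2 (by positivity)
  have htt : t * t = 2 * s := Real.mul_self_sqrt (by positivity)
  set β := t / r with hβ
  have hβ0 : 0 < β := by positivity
  have hn0 : (0 : ℝ) < Fintype.card ι := Nat.cast_pos.2 Fintype.card_pos
  -- `c` bounds the expected sum of exponentials. The tangent line log S ≤ S/c + log c - 1 gives an
  -- envelope linear in them, with expectation at most (log c)/β ≤ 2s/β = r t.
  set c := Fintype.card ι * Real.exp s with hc
  have hc0 : 0 < c := by positivity
  classical
  set v' : ι → Space d := fun i => if ‖v i‖ ≤ r then v i else 0 with hv'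
  have hv'r : ∀ i, ‖v' i‖ ≤ r := by
    intro i; simp only [hv']; split_ifs with h
    · exact h
    · simpa using hr.le
  have hi : Integrable (fun z : Space d => ∑ i, Real.exp (inner ℝ z (β • v' i)))
      (stdGaussian (Space d)) :=
    integrable_finsetSum _ fun i _ => integrable_exp_inner _
  refine ⟨fun z => β⁻¹ * ((∑ i, Real.exp (inner ℝ z (β • v' i))) / c + (Real.log c - 1)),
    ((hi.div_const _).add (integrable_const _)).const_mul _, ?_, ?_⟩
  · rintro z _ ⟨⟨i, rfl⟩, hi⟩
    rw [mem_closedBall_zero_iff] at hi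
    have e : v i = v' i := by simp [hv', hi]
    simp only [e]
    rw [← div_eq_inv_mul, le_div_iff₀ hβ0, mul_comm, ← real_inner_smul_right]
    set y := inner ℝ z (β • v' i)
    have h1 : Real.exp y ≤ ∑ i, Real.exp (inner ℝ z (β • v' i)) :=
      Finset.single_le_sum (f := fun i => Real.exp (inner ℝ z (β • v' i)))
        (fun _ _ => (Real.exp_pos _).le) (Finset.mem_univ i)
    have h2 : y - Real.log c + 1 ≤ Real.exp y / c := by
      have := Real.add_one_le_exp (y - Real.log c)
      rwa [Real.exp_sub, Real.exp_log hc0] at this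
    have h3 : Real.exp y / c ≤ (∑ i, Real.exp (inner ℝ z (β • v' i))) / c := by gcongr
    linarith
  · rw [integral_const_mul, integral_add (hi.div_const _) (integrable_const _), integral_div,
      integral_finsetSum _ fun i _ => integrable_exp_inner _]
    simp_rw [integral_exp_inner]
    have h1 : ∑ i, Real.exp (‖β • v' i‖ ^ 2 / 2) ≤ c := by
      calc _ ≤ ∑ _i : ι, Real.exp s := by
            refine Finset.sum_le_sum fun i _ => Real.exp_le_exp.2 ?_
            rw [norm_smul, Real.norm_of_nonneg hβ0.le]
            have : β * ‖v' i‖ ≤ t := by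
              calc β * ‖v' i‖ ≤ β * r := by gcongr; exact hv'r i
                _ = t := div_mul_cancel₀ _ hr.ne'
            have h0 : 0 ≤ β * ‖v' i‖ := by positivity
            nlinarith
        _ = c := by simp [hc]
    have h2 : (∑ i, Real.exp (‖β • v' i‖ ^ 2 / 2)) / c ≤ 1 := (div_le_one hc0).2 h1
    have h3 : Real.log c ≤ 2 * s := by
      rw [hc, Real.log_mul hn0.ne' (Real.exp_ne_zero _), Real.log_exp]; linarith
    rw [← div_eq_inv_mul, div_le_iff₀ hβ0]
    have h4 : r * t * β = 2 * s := by rw [hβ, ← htt]; field_simp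
    rw [h4]
    simp
    linarith

/-! ### Maurey nets of the l_1 ball and chaining. -/

/-- A vertex of the `l_1` ball of radius `c`. -/
noncomputable def l1Vertex (c : ℝ) (a : Fin d × Bool) : Space d :=
  EuclideanSpace.single a.1 (if a.2 then c else -c)

theorem norm_l1Vertex {c : ℝ} (hc : 0 ≤ c) (a : Fin d × Bool) : ‖l1Vertex c a‖ = c := by
  rw [l1Vertex, PiLp.norm_single]
  split_ifs <;> simp [abs_of_nonneg hc]

/-- A linear functional attains its maximum over the l_1 ball at a vertex, here given by the largest
coordinate of `w` and its sign. -/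
theorem exists_inner_sub_l1Vertex_le (hd : 1 ≤ d) {c : ℝ} {u : Space d} (hu : l1Norm u ≤ c)
    (w : Space d) : ∃ a, inner ℝ w (u - l1Vertex c a) ≤ 0 := by
  have : Nonempty (Fin d) := ⟨⟨0, hd⟩⟩
  obtain ⟨l, hl⟩ := Finite.exists_max fun l => |w l|
  have h1 : inner ℝ w u ≤ c * |w l| := by
    rw [PiLp.inner_apply]
    calc ∑ i, inner ℝ (w i) (u i) ≤ ∑ i, |u i| * |w l| := by
          refine Finset.sum_le_sum fun i _ => ?_
          calc inner ℝ (w i) (u i) ≤ ‖w i‖ * ‖u i‖ := real_inner_le_norm _ _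
            _ = |u i| * |w i| := mul_comm _ _
            _ ≤ _ := mul_le_mul_of_nonneg_left (hl i) (abs_nonneg _)
      _ = l1Norm u * |w l| := by rw [← Finset.sum_mul, l1Norm]
      _ ≤ _ := by gcongr
  rcases le_total 0 (w l) with h | h
  · refine ⟨(l, true), ?_⟩
    rw [abs_of_nonneg h] at h1
    simpa [inner_sub_right, l1Vertex, EuclideanSpace.inner_single_right] using h1
  · refine ⟨(l, false), ?_⟩
    rw [abs_of_nonpos h] at h1
    simp [inner_sub_right, l1Vertex, EuclideanSpace.inner_single_right]
    linarith

/-- Points of the `l_1` ball are approximated by averages of `k` vertices. -/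
theorem exists_norm_sub_average_l1Vertex_le (hd : 1 ≤ d) {c : ℝ} (hc : 0 ≤ c) {u : Space d}
    (hu : l1Norm u ≤ c) {k : ℕ} (hk : 1 ≤ k) :
    ∃ s : Fin k → Fin d × Bool,
      ‖u - (k : ℝ)⁻¹ • ∑ i, l1Vertex c (s i)‖ ≤ 2 * c / Real.sqrt k := by
  -- Greedy form of Maurey's argument: each new vertex makes the cross term nonpositive, so the
  -- squared norm grows by at most (2c)².
  have key : ∀ k : ℕ, ∃ s : Fin k → Fin d × Bool,
      ‖∑ i, (u - l1Vertex c (s i))‖ ^ 2 ≤ k * (2 * c) ^ 2 := by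
    intro k
    induction k with
    | zero => exact ⟨Fin.elim0, by simp⟩
    | succ k ih =>
      obtain ⟨s, hs⟩ := ih
      obtain ⟨a, ha⟩ := exists_inner_sub_l1Vertex_le hd hu (∑ i, (u - l1Vertex c (s i)))
      refine ⟨Fin.snoc s a, ?_⟩
      rw [Fin.sum_univ_castSucc]
      simp only [Fin.snoc_castSucc, Fin.snoc_last]
      rw [norm_add_sq_real]
      have h1 : ‖u - l1Vertex c a‖ ≤ 2 * c := by
        have h2 := norm_sub_le u (l1Vertex c a)
        rw [norm_l1Vertex hc] at h2
        have h3 := (norm_le_l1Norm u).trans hu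
        linarith
      have h2 : ‖u - l1Vertex c a‖ ^ 2 ≤ (2 * c) ^ 2 := by gcongr
      push_cast
      linarith
  obtain ⟨s, hs⟩ := key k
  refine ⟨s, ?_⟩
  have hk0 : (0 : ℝ) < k := Nat.cast_pos.2 hk
  have e : u - (k : ℝ)⁻¹ • ∑ i, l1Vertex c (s i) = (k : ℝ)⁻¹ • ∑ i, (u - l1Vertex c (s i)) := by
    rw [Finset.sum_sub_distrib, smul_sub]
    simp [← Nat.cast_smul_eq_nsmul ℝ, smul_smul, inv_mul_cancel₀ hk0.ne']
  rw [e, norm_smul, norm_inv, Real.norm_of_nonneg hk0.le, inv_mul_le_iff₀ hk0]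
  have h1 : ‖∑ i, (u - l1Vertex c (s i))‖ ≤ Real.sqrt k * (2 * c) := by
    refine (sq_le_sq₀ (norm_nonneg _) (by positivity)).1 ?_
    rw [mul_pow, Real.sq_sqrt hk0.le]; exact hs
  refine h1.trans (le_of_eq ?_)
  have : (k : ℝ) = Real.sqrt k * Real.sqrt k := (Real.mul_self_sqrt hk0.le).symm
  have hs0 : Real.sqrt k ≠ 0 := (Real.sqrt_pos.2 hk0).ne'
  rw [mul_div_assoc', eq_div_iff hs0, mul_right_comm, ← this]

/-- Nets of `C` obtained from nets of the `l_1` ball through the inverse of the gradient map. -/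
theorem LossFunction.exists_net {f : LossFunction C} {m C₁ : ℝ} (hd : 1 ≤ d) (hm : 0 < m)
    (hC₁ : 0 ≤ C₁) (hsc : f.IsStronglyConvex m) (hb : f.GradBounded C₁) (hne : C.Nonempty)
    {k : ℕ} (hk : 1 ≤ k) :
    ∃ π : (Fin k → Fin d × Bool) → Space d, (∀ s, π s ∈ C) ∧
      ∀ x ∈ C, ∃ s, ‖x - π s‖ ≤ 4 * C₁ / m / Real.sqrt k := by
  classical
  obtain ⟨p, hp⟩ := hne
  set A : (Fin k → Fin d × Bool) → Space d := fun s => (k : ℝ)⁻¹ • ∑ i, l1Vertex C₁ (s i)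
  -- `A s` need not be a gradient, so any point of `C` with gradient close to it is taken; this
  -- doubles the radius.
  have h : ∀ s, ∃ y ∈ C, (∃ x ∈ C, ‖f.grad x - A s‖ ≤ 2 * C₁ / Real.sqrt k) →
      ‖f.grad y - A s‖ ≤ 2 * C₁ / Real.sqrt k := by
    intro s
    by_cases h : ∃ x ∈ C, ‖f.grad x - A s‖ ≤ 2 * C₁ / Real.sqrt k
    · obtain ⟨x, hx, hxs⟩ := h
      exact ⟨x, hx, fun _ => hxs⟩
    · exact ⟨p, hp, fun h' => absurd h' h⟩
  choose π hπ hπ' using h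
  refine ⟨π, hπ, fun x hx => ?_⟩
  obtain ⟨s, hs⟩ := exists_norm_sub_average_l1Vertex_le hd hC₁ (hb x hx) hk
  refine ⟨s, (hsc.norm_sub_le hm hx (hπ s)).trans ?_⟩
  have h1 := hπ' s ⟨x, hx, hs⟩
  have h2 : ‖f.grad x - f.grad (π s)‖ ≤ 2 * C₁ / Real.sqrt k + 2 * C₁ / Real.sqrt k := by
    calc _ ≤ ‖f.grad x - A s‖ + ‖A s - f.grad (π s)‖ := norm_sub_le_norm_sub_add_norm_sub _ _ _
      _ ≤ _ := add_le_add hs (by rw [norm_sub_rev]; exact h1)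
  calc _ ≤ (2 * C₁ / Real.sqrt k + 2 * C₁ / Real.sqrt k) / m := by gcongr
    _ = _ := by ring

/-- A domain which carries a strongly convex function with gradients in an `l_1` ball has Gaussian
width polylogarithmic in the dimension. -/
theorem LossFunction.hasWidthLE {f : LossFunction C} {m C₁ : ℝ} (hd : 1 ≤ d) (hm : 0 < m)
    (hC₁ : 0 < C₁) (hsc : f.IsStronglyConvex m) (hb : f.GradBounded C₁) {p : Space d} (hp : p ∈ C)
    {Λ : ℝ} (hΛ : 1 ≤ Λ) (hdΛ : Real.log (2 + d) ≤ Λ) :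
    HasWidthLE ((fun x => x - p) '' C) (124 * C₁ / m * Λ ^ 2) := by
  have hd0 : (1 : ℝ) ≤ d := by exact_mod_cast hd
  have : Nonempty (Fin d × Bool) := ⟨(⟨0, hd⟩, true)⟩
  have hpos : ∀ j : ℕ, 1 ≤ 4 ^ j := fun j => Nat.one_le_pow _ _ (by norm_num)
  choose π hπ hπ' using fun j : ℕ => f.exists_net hd hm hC₁.le hsc hb ⟨p, hp⟩ (hpos j)
  have hsqrt : ∀ j : ℕ, Real.sqrt ((4 ^ j : ℕ) : ℝ) = 2 ^ j := by
    intro j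
    rw [show ((4 ^ j : ℕ) : ℝ) = (2 ^ j) ^ 2 by push_cast; rw [← pow_mul, mul_comm, pow_mul]; norm_num]
    exact Real.sqrt_sq (by positivity)
  simp_rw [hsqrt] at hπ'
  set r := 4 * C₁ / m with hr
  have hr0 : 0 < r := by positivity
  have hlog0 : 0 < Real.log (2 * d) := Real.log_pos (by linarith)
  have hlog : Real.log (2 * d) ≤ 2 * Λ := by
    calc Real.log (2 * d) ≤ Real.log ((2 + d) ^ 2) := by
          apply Real.log_le_log (by positivity); nlinarith
      _ = 2 * Real.log (2 + d) := by rw [Real.log_pow]; norm_num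
      _ ≤ _ := by linarith
  have hcard : ∀ k : ℕ, Real.log (Fintype.card (Fin k → Fin d × Bool)) = k * Real.log (2 * d) := by
    intro k
    simp [mul_comm (2 : ℝ)]
  set w := r * (5 * Λ) with hw
  have hsΛ : Real.sqrt (20 * Λ) ≤ 5 * Λ := by
    rw [Real.sqrt_le_left (by positivity)]; nlinarith
  -- Chaining with k = 4^j: links between levels j and j + 1 have norm at most r/2^j and come from
  -- (2d)^(5·4^j) pairs, so each level costs at most r √(20Λ) ≤ w, whatever j.
  have hlevel : ∀ j : ℕ, HasWidthLE ((fun x => x - p) '' Set.range (π j)) ((j + 1) * w) := by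
    intro j
    induction j with
    | zero =>
      refine (hasWidthLE_range (fun s => π 0 s - p) hr0 (s := Real.log (2 * d)) hlog0
        (by rw [hcard]; simp)).mono ?_ ?_
      · rintro _ ⟨_, ⟨s, rfl⟩, rfl⟩
        refine ⟨⟨s, rfl⟩, mem_closedBall_zero_iff.2 ?_⟩
        refine (hsc.norm_sub_le_of_gradBounded hm hb (hπ 0 s) hp).trans ?_
        rw [hr]; gcongr; norm_num
      · simp only [Nat.cast_zero, zero_add, one_mul]
        rw [hw]; gcongr
        refine (Real.sqrt_le_sqrt ?_).trans hsΛ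
        linarith
    | succ j ih =>
      have hinc := hasWidthLE_range (fun s : (Fin (4 ^ j) → Fin d × Bool) ×
          (Fin (4 ^ (j + 1)) → Fin d × Bool) => π (j + 1) s.2 - π j s.1)
        (r := r / 2 ^ j) (s := 5 * 4 ^ j * Real.log (2 * d)) (by positivity) (by positivity) (by
          rw [Fintype.card_prod, Nat.cast_mul, Real.log_mul (by positivity) (by positivity),
            hcard, hcard]
          push_cast; rw [pow_succ]; linarith)
      refine (ih.add hinc (U := (fun x => x - p) '' Set.range (π (j + 1))) ?_).mono subset_rfl ?_
      · rintro _ ⟨_, ⟨s, rfl⟩, rfl⟩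
        obtain ⟨s', hs'⟩ := hπ' j _ (hπ (j + 1) s)
        exact ⟨_, ⟨_, ⟨s', rfl⟩, rfl⟩, _, ⟨⟨(s', s), rfl⟩, mem_closedBall_zero_iff.2 hs'⟩,
          by simp⟩
      · have h1 : r / 2 ^ j * Real.sqrt (2 * (5 * 4 ^ j * Real.log (2 * d))) ≤ w := by
          have h2 : Real.sqrt (2 * (5 * 4 ^ j * Real.log (2 * d)))
              ≤ 2 ^ j * Real.sqrt (20 * Λ) := by
            have h3 : (2 : ℝ) ^ j = Real.sqrt (4 ^ j) := by have := hsqrt j; push_cast at this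
                                                            exact this.symm
            rw [h3, ← Real.sqrt_mul (by positivity)]
            apply Real.sqrt_le_sqrt
            have : (4 : ℝ) ^ j * Real.log (2 * d) ≤ 4 ^ j * (2 * Λ) := by gcongr
            linarith
          calc _ ≤ r / 2 ^ j * (2 ^ j * Real.sqrt (20 * Λ)) := by gcongr
            _ = r * Real.sqrt (20 * Λ) := by field_simp
            _ ≤ _ := by rw [hw]; gcongr
        push_cast
        linarith
  -- Chaining stops once 2^J ≥ √d (as e < 4), when the residual ball of radius r/2^J has width at
  -- most r.
  set J := ⌈Real.log d⌉₊ with hJ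
  have hlogd : 0 ≤ Real.log d := Real.log_nonneg hd0
  have hJ1 : (J : ℝ) ≤ Λ + 1 := by
    have h1 := (Nat.ceil_lt_add_one hlogd).le
    have h2 : Real.log d ≤ Real.log (2 + d) := Real.log_le_log (by positivity) (by linarith)
    linarith
  have hJ2 : Real.sqrt d ≤ 2 ^ J := by
    rw [← hsqrt J]
    apply Real.sqrt_le_sqrt
    push_cast
    calc (d : ℝ) = Real.exp (Real.log d) := (Real.exp_log (by positivity)).symm
      _ ≤ Real.exp (J * 1) := Real.exp_le_exp.2 (by rw [mul_one]; exact Nat.le_ceil _)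
      _ = Real.exp 1 ^ J := Real.exp_nat_mul _ _
      _ ≤ 4 ^ J := by gcongr; linarith [Real.exp_one_lt_d9]
  refine ((hlevel J).add (hasWidthLE_closedBall hd (r := r / 2 ^ J) (by positivity))
    (U := (fun x => x - p) '' C) ?_).mono subset_rfl ?_
  · rintro _ ⟨x, hx, rfl⟩
    obtain ⟨s, hs⟩ := hπ' J x hx
    exact ⟨_, ⟨_, ⟨s, rfl⟩, rfl⟩, x - π J s, mem_closedBall_zero_iff.2 hs, by simp⟩
  · have h1 : r / 2 ^ J * Real.sqrt d ≤ r := by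
      rw [div_mul_eq_mul_div, div_le_iff₀ (by positivity)]; gcongr
    have h2 : (J + 1 : ℝ) * w ≤ (Λ + 1 + 1) * w := by gcongr
    have h3 : (Λ + 1 + 1) * w + r ≤ 31 * Λ ^ 2 * r := by
      rw [hw]
      have : (Λ + 1 + 1) * (5 * Λ) + 1 ≤ 31 * Λ ^ 2 := by nlinarith
      have := mul_le_mul_of_nonneg_right this hr0.le
      linarith
    have h4 : 31 * Λ ^ 2 * r = 124 * C₁ / m * Λ ^ 2 := by rw [hr]; ring
    linarith

/-! ### Expectations against the noise of one round. -/

theorem measurePreserving_noise_eval (k : Fin K) (i : Fin N) :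
    MeasurePreserving (fun ω : Noise d N K => ω k i) (noiseLaw d N K)
      (stdGaussian (Space d)) :=
  (measurePreserving_eval (fun _ : Fin N => stdGaussian (Space d)) i).comp
    (measurePreserving_eval
      (fun _ : Fin K => Measure.pi fun _ : Fin N => stdGaussian (Space d)) k)

theorem measurePreserving_neg_stdGaussian :
    MeasurePreserving (fun z : Space d => -z) (stdGaussian (Space d)) (stdGaussian (Space d)) :=
  ⟨measurable_neg, stdGaussian_map (LinearIsometryEquiv.neg ℝ)⟩

/-- Change of sign of the noise of round `k`. -/
def Noise.flip (k : Fin K) (ω : Noise d N K) : Noise d N K :=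
  fun j => if j = k then fun i => -ω j i else ω j

theorem measurePreserving_flip (k : Fin K) :
    MeasurePreserving (Noise.flip k) (noiseLaw d N K) (noiseLaw d N K) := by
  have hneg : MeasurePreserving (fun (z : Fin N → Space d) i => -z i)
      (Measure.pi fun _ : Fin N => stdGaussian (Space d))
      (Measure.pi fun _ : Fin N => stdGaussian (Space d)) :=
    measurePreserving_pi _ _ fun _ => measurePreserving_neg_stdGaussian
  have h := measurePreserving_pi
    (fun _ : Fin K => Measure.pi fun _ : Fin N => stdGaussian (Space d))
    (fun _ : Fin K => Measure.pi fun _ : Fin N => stdGaussian (Space d))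
    (f := fun j z => if j = k then fun i => -z i else z) (fun j => by
      by_cases hj : j = k
      · simpa [hj] using hneg
      · simpa [hj] using! MeasurePreserving.id _)
  exact h

/-- The perturbation of the aggregate in round `k`. -/
noncomputable def meanNoise (σ : ℝ) (k : ℕ) (ω : Noise d N K) : Space d :=
  (σ / N) • ∑ i, ω.extend k i

theorem meanNoise_apply {σ : ℝ} (k : Fin K) (ω : Noise d N K) :
    meanNoise σ k ω = (σ / N) • ∑ i, ω k i := by
  simp [meanNoise, Noise.extend]

theorem continuous_meanNoise (σ : ℝ) (k : ℕ) :
    Continuous (meanNoise σ k : Noise d N K → Space d) := by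
  have h : ∀ i, Continuous fun ω : Noise d N K => ω.extend k i := fun i =>
    (continuous_apply i).comp (continuous_extend k)
  have h2 : Continuous fun ω : Noise d N K => ∑ i, ω.extend k i :=
    continuous_finsetSum _ fun i _ => h i
  exact h2.const_smul (σ / N)

theorem integrable_norm_meanNoise (σ : ℝ) (k : Fin K) :
    Integrable (fun ω : Noise d N K => ‖meanNoise σ k ω‖) (noiseLaw d N K) := by
  have e : meanNoise σ k = fun ω : Noise d N K => (σ / N) • ∑ i, ω k i :=
    funext fun ω => meanNoise_apply k ω
  refine Integrable.norm ?_
  rw [e]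
  have h : Integrable (fun ω : Noise d N K => ∑ i, ω k i) (noiseLaw d N K) := by
    refine integrable_finsetSum _ fun i _ => ?_
    exact (measurePreserving_noise_eval k i).integrable_comp_of_integrable
      (IsGaussian.integrable_id (μ := stdGaussian (Space d)))
  exact h.smul (σ / N : ℝ)

theorem integrable_inner_meanNoise {σ R : ℝ} (k : Fin K) {u : Noise d N K → Space d}
    (hu : Continuous u) (hR : ∀ ω, ‖u ω‖ ≤ R) :
    Integrable (fun ω => inner ℝ (meanNoise σ k ω) (u ω)) (noiseLaw d N K) := by
  refine ((integrable_norm_meanNoise σ k).mul_const R).mono'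
    ((continuous_meanNoise σ k).inner hu).aestronglyMeasurable (.of_forall fun ω => ?_)
  exact (norm_inner_le_norm _ _).trans (by gcongr; exact hR ω)

/-- The sign change preserves the law and `u` but negates the mean noise. Invariance under it stands
in for independence of `u` from round `k`. -/
theorem integral_inner_meanNoise_eq_zero {σ : ℝ} (k : Fin K) {u : Noise d N K → Space d}
    (hu : Continuous u) (hk : ∀ ω, u (ω.flip k) = u ω) :
    ∫ ω, inner ℝ (meanNoise σ k ω) (u ω) ∂noiseLaw d N K = 0 := by
  have hmp := measurePreserving_flip (d := d) (N := N) k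
  have h1 : ∫ ω, inner ℝ (meanNoise σ k ω) (u ω) ∂noiseLaw d N K
      = ∫ ω, inner ℝ (meanNoise σ k (ω.flip k)) (u (ω.flip k)) ∂noiseLaw d N K := by
    conv_lhs => rw [← hmp.map_eq]
    exact integral_map hmp.measurable.aemeasurable
      ((continuous_meanNoise σ k).inner hu).aestronglyMeasurable
  have h2 : ∀ ω : Noise d N K, meanNoise σ k (ω.flip k) = -meanNoise σ k ω := by
    intro ω; simp [meanNoise_apply, Noise.flip]
  simp_rw [h2, hk, inner_neg_left] at h1
  rw [integral_neg] at h1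
  linarith

/-- Here `u` may depend on the noise of round `k`: the envelope of the width bounds each agent's
contribution pointwise, before integration. -/
theorem integral_inner_meanNoise_le [NeZero N] {σ w : ℝ} (hσ : 0 ≤ σ) (k : Fin K)
    {T : Set (Space d)} (hT : HasWidthLE T w) {u : Noise d N K → Space d} {R : ℝ}
    (hu : Continuous u) (hR : ∀ ω, ‖u ω‖ ≤ R) (huT : ∀ ω, u ω ∈ T) :
    ∫ ω, inner ℝ (meanNoise σ k ω) (u ω) ∂noiseLaw d N K ≤ σ * w := by
  obtain ⟨Φ, hi, hle, hint⟩ := hT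
  have hN : (0 : ℝ) < N := Nat.cast_pos.2 (NeZero.pos N)
  have hi' : ∀ i, Integrable (fun ω : Noise d N K => Φ (ω k i)) (noiseLaw d N K) := fun i =>
    (measurePreserving_noise_eval k i).integrable_comp_of_integrable hi
  have he : ∀ i, ∫ ω : Noise d N K, Φ (ω k i) ∂noiseLaw d N K
      = ∫ z, Φ z ∂stdGaussian (Space d) := by
    intro i
    have hmp := measurePreserving_noise_eval (d := d) k i
    rw [← hmp.map_eq]
    exact (integral_map hmp.measurable.aemeasurable
      (hmp.map_eq.symm ▸ hi.aestronglyMeasurable)).symm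
  calc _ ≤ ∫ ω : Noise d N K, σ / N * ∑ i, Φ (ω k i) ∂noiseLaw d N K := by
        refine integral_mono (integrable_inner_meanNoise k hu hR)
          ((integrable_finsetSum _ fun i _ => hi' i).const_mul _) fun ω => ?_
        simp only [meanNoise_apply, real_inner_smul_left, sum_inner]
        gcongr
        exact hle _ _ (huT ω)
    _ = σ / N * ∑ _i : Fin N, ∫ z, Φ z ∂stdGaussian (Space d) := by
        rw [integral_const_mul, integral_finsetSum _ fun i _ => hi' i]
        simp_rw [he]
    _ = σ * ∫ z, Φ z ∂stdGaussian (Space d) := by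
        simp; field_simp
    _ ≤ _ := by gcongr

theorem iterate_congr {f : Fin N → LossFunction C} {η σ : ℝ} {s : Fin N → Space d}
    {Z Z' : ℕ → Fin N → Space d} {k : ℕ} (h : ∀ j < k, Z j = Z' j) :
    iterate f η σ s Z k = iterate f η σ s Z' k := by
  induction k with
  | zero => rfl
  | succ k ih =>
    rw [iterate_succ, iterate_succ, ih fun j hj => h j (by omega), h k (by omega)]

theorem iterate_flip {f : Fin N → LossFunction C} {η σ : ℝ} {s : Fin N → Space d} (k : Fin K)
    {j : ℕ} (hj : j ≤ k) (ω : Noise d N K) :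
    iterate f η σ s (ω.flip k).extend j = iterate f η σ s ω.extend j := by
  refine iterate_congr fun i hi => ?_
  have hiK : i < K := by omega
  have : (⟨i, hiK⟩ : Fin K) ≠ k := by
    intro h; have := congrArg Fin.val h; simp at this; omega
  simp [Noise.extend, hiK, Noise.flip, this]

/-! ### Expected gap of the last aggregate. -/

/-- The aggregate after `k` rounds, as a random variable. -/
noncomputable def aggregateAt (f : Fin N → LossFunction C) (η σ : ℝ) (x0 : Fin N → Space d)
    (k : ℕ) (ω : Noise d N K) : Space d :=
  aggregate C (iterate f η σ x0 ω.extend k)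

theorem aggregateAt_succ [NeZero N] (f : Fin N → LossFunction C) (η σ : ℝ)
    (x0 : Fin N → Space d) (k : ℕ) (ω : Noise d N K) :
    aggregateAt f η σ x0 (k + 1) ω = proj C (aggregateAt f η σ x0 k ω
      - η • (LossFunction.average f).grad (aggregateAt f η σ x0 k ω) + meanNoise σ k ω) :=
  aggregate_step f η σ _ _

/-- The expected optimality gap of the last iterate. -/
theorem integral_average_val_sub_le [NeZero N] {f : Fin N → LossFunction C}
    {m M C₁ σ w : ℝ} {n L : ℕ} (hm : 0 < m) (hmM : m ≤ M) (hσ : 0 ≤ σ)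
    (hw : 0 ≤ w) (hn : M / m ≤ n) (hcl : IsClosed C) (hcv : Convex ℝ C)
    (hsc : ∀ i, (f i).IsStronglyConvex m) (hsm : ∀ i, (f i).IsSmooth M)
    (hb : ∀ i, (f i).GradBounded C₁) {p : Space d} (hp : p ∈ C)
    (hmin : IsMinOn (LossFunction.average f).val C p)
    (hwidth : HasWidthLE ((fun x => x - p) '' C) w) (x0 : Fin N → Space d)
    (hK : K = n * L + n) :
    Integrable (fun ω : Noise d N K =>
        (LossFunction.average f).val (aggregateAt f M⁻¹ σ x0 K ω)) (noiseLaw d N K) ∧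
      ∫ ω : Noise d N K, (LossFunction.average f).val (aggregateAt f M⁻¹ σ x0 K ω)
          ∂noiseLaw d N K - (LossFunction.average f).val p
        ≤ m / 2 * Real.exp (-L) * (2 * C₁ / m) ^ 2 + M * (σ * w) * (2 + Real.log n) := by
  have hM : 0 < M := hm.trans_le hmM
  have hne : C.Nonempty := ⟨p, hp⟩
  set g := LossFunction.average f with hg
  have hgsc : g.IsStronglyConvex m := LossFunction.average_isStronglyConvex hsc
  have hgsm : g.IsSmooth M := LossFunction.average_isSmooth hsm
  have i0 : Fin N := ⟨0, NeZero.pos N⟩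
  have hdiam : ∀ x ∈ C, ∀ y ∈ C, ‖x - y‖ ≤ 2 * C₁ / m := fun x hx y hy =>
    (hsc i0).norm_sub_le_of_gradBounded hm (hb i0) hx hy
  have hcomp : IsCompact C := (hsc i0).isCompact hm (hb i0) hcl
  set X : ℕ → Noise d N K → Space d := fun k => aggregateAt f M⁻¹ σ x0 k with hX
  have hXC : ∀ k ω, X k ω ∈ C := fun k ω => aggregate_mem hne hcl _
  have hXc : ∀ k, Continuous (X k) := fun k => by
    have h1 := (continuous_iterate (η := M⁻¹) (σ := σ) (K := K) hne hcl hcv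
      (fun i => (hsm i).continuousOn_grad) k).comp (Continuous.prodMk_right x0)
    exact (continuous_aggregate hne hcl hcv).comp h1
  obtain ⟨b, hbd⟩ := hcomp.exists_bound_of_continuousOn g.continuousOn_val
  have hval : ∀ k, Integrable (fun ω => g.val (X k ω)) (noiseLaw d N K) := fun k =>
    Integrable.of_bound
      ((g.continuousOn_val.comp_continuous (hXc k) (hXC k)).aestronglyMeasurable) b
      (.of_forall fun ω => hbd _ (hXC k ω))
  have hsq : ∀ k, ∀ Y : Noise d N K → Space d, Continuous Y → (∀ ω, Y ω ∈ C) →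
      Integrable (fun ω => ‖X k ω - Y ω‖ ^ 2) (noiseLaw d N K) := fun k Y hY hYC =>
    Integrable.of_bound (((hXc k).sub hY).norm.pow 2).aestronglyMeasurable ((2 * C₁ / m) ^ 2)
      (.of_forall fun ω => by
        rw [Real.norm_of_nonneg (sq_nonneg _)]
        gcongr
        exact hdiam _ (hXC k ω) _ (hYC ω))
  set V := M * (σ * w) with hV
  -- `Y` does not see the noise of round `k`, so it is exchanged for the fixed point `p` at no cost;
  -- the width handles the dependence of `X (k + 1)` on that noise.
  have hnoise : ∀ k : Fin K, ∀ Y : Noise d N K → Space d, Continuous Y → (∀ ω, Y ω ∈ C) →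
      (∀ ω, Y (ω.flip k) = Y ω) →
      ∫ ω, inner ℝ (meanNoise σ k ω) (X (k + 1) ω - Y ω) ∂noiseLaw d N K ≤ σ * w := by
    intro k Y hY hYC hYk
    have e : ∀ ω, inner ℝ (meanNoise σ k ω) (X (k + 1) ω - Y ω)
        = inner ℝ (meanNoise σ k ω) (X (k + 1) ω - p)
          + inner ℝ (meanNoise σ k ω) (p - Y ω) := by
      intro ω; rw [← inner_add_right]; congr 1; abel
    have c1 : Continuous fun ω => X (k + 1) ω - p := (hXc _).sub continuous_const
    have c2 : Continuous fun ω => p - Y ω := continuous_const.sub hY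
    have b1 : ∀ ω, ‖X (k + 1) ω - p‖ ≤ 2 * C₁ / m := fun ω => hdiam _ (hXC _ ω) _ hp
    simp_rw [e]
    rw [integral_add (integrable_inner_meanNoise k c1 b1)
      (integrable_inner_meanNoise k c2 fun ω => hdiam _ hp _ (hYC ω)),
      integral_inner_meanNoise_eq_zero k c2 (fun ω => by rw [hYk]), add_zero]
    exact integral_inner_meanNoise_le hσ k hwidth c1 b1 fun ω => ⟨_, hXC _ ω, rfl⟩
  have hstep : ∀ k : Fin K, ∀ Y : Noise d N K → Space d, Continuous Y → (∀ ω, Y ω ∈ C) →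
      (∀ ω, Y (ω.flip k) = Y ω) → Integrable (fun ω => g.val (Y ω)) (noiseLaw d N K) →
      ∫ ω, g.val (X (k + 1) ω) ∂noiseLaw d N K - ∫ ω, g.val (Y ω) ∂noiseLaw d N K
        ≤ M / 2 * ((1 - m / M) * ∫ ω, ‖X k ω - Y ω‖ ^ 2 ∂noiseLaw d N K
          - ∫ ω, ‖X (k + 1) ω - Y ω‖ ^ 2 ∂noiseLaw d N K) + V := by
    intro k Y hY hYC hYk hYi
    have hin : Integrable (fun ω => inner ℝ (meanNoise σ k ω) (X (k + 1) ω - Y ω))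
        (noiseLaw d N K) :=
      integrable_inner_meanNoise k ((hXc _).sub hY) fun ω => hdiam _ (hXC _ ω) _ (hYC ω)
    have hA := (hsq k Y hY hYC).const_mul (1 - m / M)
    have hB := hsq (k + 1) Y hY hYC
    have hAB : Integrable (fun ω => M / 2 * ((1 - m / M) * ‖X k ω - Y ω‖ ^ 2
        - ‖X (k + 1) ω - Y ω‖ ^ 2)) (noiseLaw d N K) := (hA.sub hB).const_mul _
    calc _ = ∫ ω, (g.val (X (k + 1) ω) - g.val (Y ω)) ∂noiseLaw d N K :=
          (integral_sub (hval _) hYi).symm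
      _ ≤ ∫ ω, (M / 2 * ((1 - m / M) * ‖X k ω - Y ω‖ ^ 2 - ‖X (k + 1) ω - Y ω‖ ^ 2)
            + M * inner ℝ (meanNoise σ k ω) (X (k + 1) ω - Y ω)) ∂noiseLaw d N K := by
          refine integral_mono ((hval _).sub hYi)
            (hAB.add (hin.const_mul _)) fun ω => ?_
          exact LossFunction.val_proj_sub_le hcl hcv hM hgsc hgsm (hXC k ω) (hYC ω)
            (aggregateAt_succ f M⁻¹ σ x0 k ω)
      _ = M / 2 * ((1 - m / M) * ∫ ω, ‖X k ω - Y ω‖ ^ 2 ∂noiseLaw d N K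
            - ∫ ω, ‖X (k + 1) ω - Y ω‖ ^ 2 ∂noiseLaw d N K)
            + M * ∫ ω, inner ℝ (meanNoise σ k ω) (X (k + 1) ω - Y ω) ∂noiseLaw d N K := by
          rw [integral_add hAB (hin.const_mul _), integral_const_mul,
            integral_sub hA hB, integral_const_mul, integral_const_mul]
      _ ≤ _ := by rw [hV]; gcongr; exact hnoise k Y hY hYC hYk
  set a : ℕ → ℝ := fun k => ∫ ω, g.val (X k ω) ∂noiseLaw d N K - g.val p with ha
  refine ⟨hval K, ?_⟩
  have hpair : ∀ j l : ℕ, j ≤ l → l < K → a (l + 1) - a j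
      ≤ M / 2 * (∫ ω, ‖X l ω - X j ω‖ ^ 2 ∂noiseLaw d N K
        - ∫ ω, ‖X (l + 1) ω - X j ω‖ ^ 2 ∂noiseLaw d N K) + V := by
    intro j l hjl hl
    have h := hstep ⟨l, hl⟩ (X j) (hXc j) (hXC j)
      (fun ω => by simp only [hX, aggregateAt]; rw [iterate_flip _ hjl]) (hval j)
    simp only at h
    have h0 : 0 ≤ ∫ ω, ‖X l ω - X j ω‖ ^ 2 ∂noiseLaw d N K :=
      integral_nonneg fun ω => sq_nonneg _
    have h1 : (1 - m / M) * ∫ ω, ‖X l ω - X j ω‖ ^ 2 ∂noiseLaw d N K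
        ≤ ∫ ω, ‖X l ω - X j ω‖ ^ 2 ∂noiseLaw d N K := by
      have : 0 ≤ m / M * ∫ ω, ‖X l ω - X j ω‖ ^ 2 ∂noiseLaw d N K := by positivity
      linarith
    have h2 := mul_le_mul_of_nonneg_left (sub_le_sub_right h1
      (∫ ω, ‖X (l + 1) ω - X j ω‖ ^ 2 ∂noiseLaw d N K)) (by positivity : 0 ≤ M / 2)
    simp only [ha]
    linarith
  -- Comparison with the earlier iterate `X j`: the telescoping starts at ‖X j - X j‖ = 0, so no
  -- initial distance appears.
  have hpart : ∀ j t : ℕ, j + t ≤ K → ∑ i ∈ Finset.range t, (a (j + i + 1) - a j)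
      ≤ t * V - M / 2 * ∫ ω, ‖X (j + t) ω - X j ω‖ ^ 2 ∂noiseLaw d N K := by
    intro j t
    induction t with
    | zero => intro _; simp
    | succ t ih =>
      intro ht
      have h1 := ih (by omega)
      have h2 := hpair j (j + t) (by omega) (by omega)
      rw [Finset.sum_range_succ]
      push_cast
      rw [← add_assoc j t 1]
      linarith
  have hfinal := last_iterate_le (a := a)
    (D := fun k => ∫ ω, ‖X k ω - p‖ ^ 2 ∂noiseLaw d N K) (R := 2 * C₁ / m) (L := L) (V := V)
    hm hM hmM (by positivity) hn
    (fun k => by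
      have : ∫ _ω : Noise d N K, g.val p ∂noiseLaw d N K
          ≤ ∫ ω, g.val (X k ω) ∂noiseLaw d N K :=
        integral_mono (integrable_const _) (hval k) fun ω => hmin (hXC k ω)
      simp only [integral_const, probReal_univ, one_smul] at this
      simp only [ha]; linarith)
    (fun k => integral_nonneg fun ω => sq_nonneg _)
    (by
      have : ∫ ω, ‖X 0 ω - p‖ ^ 2 ∂noiseLaw d N K
          ≤ ∫ _ω : Noise d N K, (2 * C₁ / m) ^ 2 ∂noiseLaw d N K :=
        integral_mono (hsq 0 (fun _ => p) continuous_const fun _ => hp) (integrable_const _)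
          fun ω => by
            have := hdiam _ (hXC 0 ω) _ hp
            dsimp only
            gcongr
      simpa using this)
    (fun k hk => by
      have := hstep ⟨k, hK ▸ hk⟩ (fun _ => p) continuous_const (fun _ => hp) (fun _ => rfl)
        (integrable_const _)
      simpa [ha] using this)
    (fun k hk => by
      rw [← hK] at hk ⊢
      have h1 := hpart (K - k) k (by omega)
      rw [← Finset.sum_range_reflect] at h1
      have h2 : ∑ j ∈ Finset.range k, (a (K - k + (k - 1 - j) + 1) - a (K - k))
          = ∑ i ∈ Finset.range k, (a (K - i) - a (K - k)) := by
        refine Finset.sum_congr rfl fun i hi => ?_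
        rw [Finset.mem_range] at hi
        congr 2; omega
      rw [h2] at h1
      have h3 : 0 ≤ M / 2 * ∫ ω, ‖X (K - k + k) ω - X (K - k) ω‖ ^ 2 ∂noiseLaw d N K :=
        mul_nonneg (by positivity) (integral_nonneg fun ω => sq_nonneg _)
      linarith)
  rw [← hK] at hfinal
  exact hfinal

/-! ### Parameters and conclusion. -/

theorem sqrt_mul_div_rpow_eq {m M C₁ B₁ ε : ℝ} (hm : 0 < m) (hM : 0 < M) :
    Real.sqrt M * N * C₁ * B₁ / (m ^ (3 / 2 : ℝ) * ε)
      = N * (Real.sqrt (M / m) * (C₁ * B₁ / (m * ε))) := by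
  have h : m ^ (3 / 2 : ℝ) = m * Real.sqrt m := by
    rw [show (3 / 2 : ℝ) = 1 + 1 / 2 by norm_num, Real.rpow_add hm, Real.rpow_one,
      Real.sqrt_eq_rpow]
  rw [h, Real.sqrt_div hM.le]
  have : Real.sqrt m ≠ 0 := (Real.sqrt_pos.2 hm).ne'
  field_simp

/-- For the first summand, exp(-L) ≤ T⁻² beats (C₁/B₁)(1/δ), and ε δ ≤ 1. In the second, the square
root contributes one power of Λ, the width two and log n one; 2604 = 7 · 124 · 3. -/
theorem gap_bound_le {m M C₁ B₁ ε δ T Λ : ℝ} {n L : ℕ} (hm : 0 < m) (hmM : m ≤ M)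
    (hC₁ : 0 < C₁) (hB₁ : 0 < B₁) (hδ : 0 < δ) (hδ' : δ < 1) (hε : 0 < ε)
    (hεδ : ε ≤ 1 + Real.log (1 / δ)) (hT : T = Real.exp Λ) (hΛ : 1 ≤ Λ) (hTκ : M / m + 1 ≤ T)
    (hTδ : 1 / δ ≤ T) (hTC : C₁ / B₁ ≤ T) (hn : n = ⌈M / m⌉₊) (hL : L = ⌈2 * Λ⌉₊) :
    m / 2 * Real.exp (-L) * (2 * C₁ / m) ^ 2
      + M * (M⁻¹ * B₁ * Real.sqrt (3 * (1 + Real.log (1 / δ)) * (n * L + n : ℕ)) / ε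
        * (124 * C₁ / m * Λ ^ 2)) * (2 + Real.log n)
      ≤ 2606 * (Real.sqrt (M / m) * (C₁ * B₁ / (m * ε))) * Λ ^ 4 := by
  have hM : 0 < M := hm.trans_le hmM
  have hκ : 1 ≤ M / m := (one_le_div hm).2 hmM
  have hsκ : 1 ≤ Real.sqrt (M / m) := Real.one_le_sqrt.2 hκ
  have hT0 : 0 < T := hT ▸ Real.exp_pos _
  have hlogT : Real.log T = Λ := by rw [hT, Real.log_exp]
  have hlogδ : Real.log (1 / δ) ≤ Λ := hlogT ▸ Real.log_le_log (by positivity) hTδ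
  have hlogδ0 : 0 < Real.log (1 / δ) := Real.log_pos (by rw [lt_div_iff₀ hδ]; linarith)
  have hn1 : (n : ℝ) ≤ M / m + 1 := by rw [hn]; exact (Nat.ceil_lt_add_one (by positivity)).le
  have hn0 : (0 : ℝ) < n := by
    have : M / m ≤ n := by rw [hn]; exact Nat.le_ceil _
    linarith
  have hlogn : Real.log n ≤ Λ := hlogT ▸ Real.log_le_log hn0 (hn1.trans hTκ)
  have hlogn0 : 0 ≤ Real.log n := Real.log_nonneg (by exact_mod_cast (Nat.cast_pos.1 hn0))
  have hL1 : (L : ℝ) ≤ 2 * Λ + 1 := by rw [hL]; exact (Nat.ceil_lt_add_one (by positivity)).le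
  have hL2 : 2 * Λ ≤ L := by rw [hL]; exact Nat.le_ceil _
  have hG : 0 < C₁ * B₁ / (m * ε) := by positivity
  have hbias : m / 2 * Real.exp (-L) * (2 * C₁ / m) ^ 2
      ≤ 2 * (Real.sqrt (M / m) * (C₁ * B₁ / (m * ε))) := by
    have h1 : Real.exp (-L) * (C₁ / B₁ * (1 / δ)) ≤ 1 := by
      calc Real.exp (-L) * (C₁ / B₁ * (1 / δ)) ≤ Real.exp (-(2 * Λ)) * (T * T) := by
            gcongr
        _ = 1 := by rw [hT, ← Real.exp_add, ← Real.exp_add]; ring_nf; exact Real.exp_zero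
    have h2 : ε * δ ≤ 1 := by
      have h3 := Real.log_le_sub_one_of_pos (show 0 < 1 / δ by positivity)
      calc ε * δ ≤ 1 / δ * δ := by gcongr; linarith
        _ = 1 := by field_simp
    have h3 : m / 2 * Real.exp (-L) * (2 * C₁ / m) ^ 2 = 2 * (C₁ * B₁ / (m * ε))
        * (Real.exp (-L) * (C₁ / B₁ * (1 / δ))) * (ε * δ) := by field_simp
    rw [h3]
    have h4 : 0 ≤ Real.exp (-L) * (C₁ / B₁ * (1 / δ)) := by positivity
    calc _ ≤ 2 * (C₁ * B₁ / (m * ε)) * 1 * 1 := by gcongr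
      _ ≤ _ := by nlinarith
  have hsqrt : Real.sqrt (3 * (1 + Real.log (1 / δ)) * (n * L + n : ℕ))
      ≤ 7 * Real.sqrt (M / m) * Λ := by
    refine Real.sqrt_le_iff.2 ⟨by positivity, ?_⟩
    have h1 : ((n * L + n : ℕ) : ℝ) ≤ 2 * (M / m) * (4 * Λ) := by
      push_cast
      calc (n : ℝ) * L + n = n * (L + 1) := by ring
        _ ≤ _ := by gcongr <;> linarith
    calc _ ≤ 3 * (2 * Λ) * (2 * (M / m) * (4 * Λ)) := by gcongr; linarith
      _ ≤ 49 * (M / m) * Λ ^ 2 := by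
          have : 0 ≤ M / m * Λ ^ 2 := by positivity
          linarith
      _ = (7 * Real.sqrt (M / m) * Λ) ^ 2 := by
          rw [mul_pow, mul_pow, Real.sq_sqrt (by positivity)]; norm_num
  have hvar : M * (M⁻¹ * B₁ * Real.sqrt (3 * (1 + Real.log (1 / δ)) * (n * L + n : ℕ)) / ε
        * (124 * C₁ / m * Λ ^ 2)) * (2 + Real.log n)
      ≤ 2604 * (Real.sqrt (M / m) * (C₁ * B₁ / (m * ε))) * Λ ^ 4 := by
    calc _ ≤ M * (M⁻¹ * B₁ * (7 * Real.sqrt (M / m) * Λ) / ε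
          * (124 * C₁ / m * Λ ^ 2)) * (3 * Λ) := by
          gcongr
          linarith
      _ = _ := by field_simp; ring
  have hΛ4 : 1 ≤ Λ ^ 4 := one_le_pow₀ hΛ
  have hpos : 0 ≤ 2 * (Real.sqrt (M / m) * (C₁ * B₁ / (m * ε))) := by positivity
  have := le_mul_of_one_le_right hpos hΛ4
  linarith

/-- The utility of noisy decentralized gradient descent on a domain with at least two points. -/
theorem utility_of_nontrivial [NeZero N] {f : Fin N → LossFunction C} {m M C₁ B₁ ε δ T Λ : ℝ}
    {n L : ℕ} (hm : 0 < m) (hC₁ : 0 < C₁) (hB₁ : 0 < B₁) (hδ : 0 < δ) (hδ' : δ < 1) (hε : 0 < ε)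
    (hεδ : ε ≤ 1 + Real.log (1 / δ)) (hT : T = Real.exp Λ) (hΛ : 1 ≤ Λ) (hTκ : M / m + 1 ≤ T)
    (hTδ : 1 / δ ≤ T) (hTC : C₁ / B₁ ≤ T) (hTd : 2 + d ≤ T) (hn : n = ⌈M / m⌉₊)
    (hL : L = ⌈2 * Λ⌉₊) (hC : C.Nontrivial) (hcl : IsClosed C) (hcv : Convex ℝ C)
    (hsc : ∀ i, (f i).IsStronglyConvex m) (hsm : ∀ i, (f i).IsSmooth M)
    (hb : ∀ i, (f i).GradBounded C₁) (x0 : Fin N → Space d) (hK : K = n * L + n) {σ : ℝ}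
    (hσ : σ = M⁻¹ * B₁ * Real.sqrt (3 * (1 + Real.log (1 / δ)) * (n * L + n : ℕ)) / ε) :
    ∃ p ∈ C, IsMinOn (objective f) C p ∧
      Integrable (fun ω => objective f (output f M⁻¹ σ x0 ω)) (noiseLaw d N K) ∧
      ∫ ω, objective f (output f M⁻¹ σ x0 ω) ∂noiseLaw d N K - objective f p
        ≤ N * (2606 * (Real.sqrt (M / m) * (C₁ * B₁ / (m * ε))) * Λ ^ 4) := by
  have i0 : Fin N := ⟨0, NeZero.pos N⟩
  -- Two distinct points make strong convexity and smoothness comparable.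
  have hmM : m ≤ M := by
    obtain ⟨x, hx, y, hy, hxy⟩ := hC
    have h1 := (hsc i0).norm_sub_le hm hx hy
    have h2 := hsm i0 x hx y hy
    rw [le_div_iff₀ hm] at h1
    have h3 : 0 < ‖x - y‖ := norm_pos_iff.2 (sub_ne_zero.2 hxy)
    nlinarith
  have hM : 0 < M := hm.trans_le hmM
  have hd : 1 ≤ d := by
    by_contra h
    obtain rfl : d = 0 := by omega
    obtain ⟨x, _, y, _, hxy⟩ := hC
    exact hxy (Subsingleton.elim _ _)
  have hcomp : IsCompact C := (hsc i0).isCompact hm (hb i0) hcl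
  obtain ⟨p, hp, hmin⟩ := hcomp.exists_isMinOn hC.nonempty
    (LossFunction.average f).continuousOn_val
  have hlogT : Real.log T = Λ := by rw [hT, Real.log_exp]
  have hwidth := (f i0).hasWidthLE hd hm hC₁ (hsc i0) (hb i0) hp hΛ
    (hlogT ▸ Real.log_le_log (by positivity) hTd)
  have hlogδ : 0 < Real.log (1 / δ) := Real.log_pos (by rw [lt_div_iff₀ hδ]; linarith)
  have hσ0 : 0 ≤ σ := by rw [hσ]; positivity
  obtain ⟨hi, hle⟩ := integral_average_val_sub_le (f := f) (K := K) hm hmM hσ0 (by positivity)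
    (hn ▸ Nat.le_ceil _) hcl hcv hsc hsm hb hp hmin hwidth x0 hK
  have hN : (0 : ℝ) ≤ N := Nat.cast_nonneg _
  have hobj : ∀ ω : Noise d N K, objective f (output f M⁻¹ σ x0 ω)
      = N * (LossFunction.average f).val (aggregateAt f M⁻¹ σ x0 K ω) :=
    fun ω => (LossFunction.natCast_mul_average_val f _).symm
  refine ⟨p, hp, ?_, ?_, ?_⟩
  · intro x hx
    simp only [Set.mem_ofPred_eq, ← LossFunction.natCast_mul_average_val]
    exact mul_le_mul_of_nonneg_left (hmin hx) hN
  · simp_rw [hobj]; exact hi.const_mul _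
  · simp_rw [hobj]
    rw [integral_const_mul, ← LossFunction.natCast_mul_average_val, ← mul_sub]
    refine mul_le_mul_of_nonneg_left (hle.trans ?_) hN
    rw [hσ]
    exact gap_bound_le hm hmM hC₁ hB₁ hδ hδ' hε hεδ hT hΛ hTκ hTδ hTC hn hL

/-- This covers M < m, which the hypotheses permit only when `C` is a single point. -/
theorem utility_of_subsingleton {f : Fin N → LossFunction C} {η σ : ℝ} (hC : C.Subsingleton)
    (hne : C.Nonempty) (hcl : IsClosed C) (x0 : Fin N → Space d) :
    ∃ p ∈ C, IsMinOn (objective f) C p ∧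
      Integrable (fun ω => objective f (output f η σ x0 ω)) (noiseLaw d N K) ∧
      ∫ ω, objective f (output f η σ x0 ω) ∂noiseLaw d N K - objective f p ≤ 0 := by
  obtain ⟨p, hp⟩ := hne
  have h : ∀ ω : Noise d N K, output f η σ x0 ω = p := fun ω =>
    hC (aggregate_mem ⟨p, hp⟩ hcl _) hp
  refine ⟨p, hp, fun x hx => ?_, ?_, ?_⟩
  · rw [hC hx hp]; exact le_refl (objective f p)
  · simp_rw [h]; exact integrable_const _
  · simp [h]

end DecGD

theorem theorem4p2 :
    ∃ A : ℝ, 0 < A ∧ ∃ p : ℕ,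
      ∀ (N d : ℕ) (m M C₁ B₁ ε δ : ℝ), 1 ≤ N → 0 < m → 0 < M → 0 < C₁ → 0 < B₁ →
        0 < δ → δ < 1 → 0 < ε → ε ≤ 1 + Real.log (1 / δ) →
        -- the parameters of the algorithm: number of rounds, step size, noise level
        ∃ (K : ℕ) (η σ : ℝ), 0 < η ∧ 0 ≤ σ ∧
          ∀ (C : Set (DecGD.Space d)), C.Nonempty → IsClosed C → Convex ℝ C →
          ∀ F : Fin N → Set (DecGD.LossFunction C),
            (∀ i, ∀ f ∈ F i, f.IsStronglyConvex m ∧ f.IsSmooth M ∧ f.GradBounded C₁) →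
            (∀ i, DecGD.HasSensitivity (F i) B₁) →
          ∀ x0 : Fin N → DecGD.Space d, (∀ i, x0 i ∈ C) →
            DecGD.IsLDP F (DecGD.noiseLaw d N K)
              (fun f => DecGD.transcript f η σ x0) ε δ ∧
            ∀ f : Fin N → DecGD.LossFunction C, (∀ i, f i ∈ F i) →
              ∃ xstar ∈ C, IsMinOn (DecGD.objective f) C xstar ∧
                Integrable (fun ω => DecGD.objective f (DecGD.output f η σ x0 ω))
                  (DecGD.noiseLaw d N K) ∧
                ∫ ω, DecGD.objective f (DecGD.output f η σ x0 ω) ∂(DecGD.noiseLaw d N K)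
                    - DecGD.objective f xstar
                  ≤ A * (Real.sqrt M * N * C₁ * B₁ / (m ^ (3 / 2 : ℝ) * ε))
                    * Real.log (2 + d + M / m + 1 / δ + C₁ / B₁) ^ p := by
  refine ⟨2606, by norm_num, 4, ?_⟩
  intro N d m M C₁ B₁ ε δ hN hm hM hC₁ hB₁ hδ hδ' hε hεδ
  have : NeZero N := ⟨by omega⟩
  set T := 2 + d + M / m + 1 / δ + C₁ / B₁ with hT
  set Λ := Real.log T with hΛ
  have h1 : 1 < 1 / δ := by rw [lt_div_iff₀ hδ]; linarith
  have h2 : 0 < M / m := by positivity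
  have h3 : 0 < C₁ / B₁ := by positivity
  have h4 : (0 : ℝ) ≤ d := Nat.cast_nonneg d
  have hT3 : 3 ≤ T := by linarith
  have hTΛ : T = Real.exp Λ := (Real.exp_log (by linarith)).symm
  have hΛ1 : 1 ≤ Λ := by
    rw [hΛ, Real.le_log_iff_exp_le (by linarith)]
    linarith [Real.exp_one_lt_d9]
  have hlogδ : 0 < Real.log (1 / δ) := Real.log_pos h1
  set n := ⌈M / m⌉₊ with hn
  set L := ⌈2 * Λ⌉₊ with hL
  have hK0 : (0 : ℝ) < (n * L + n : ℕ) := by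
    have : 0 < n := Nat.ceil_pos.2 h2
    exact Nat.cast_pos.2 (by omega)
  -- The least noise level allowed by `isLDP_transcript`: its condition holds with equality.
  set σ := M⁻¹ * B₁ * Real.sqrt (3 * (1 + Real.log (1 / δ)) * (n * L + n : ℕ)) / ε with hσ
  have hσ0 : 0 < σ := by
    have : 0 < Real.sqrt (3 * (1 + Real.log (1 / δ)) * (n * L + n : ℕ)) :=
      Real.sqrt_pos.2 (by positivity)
    positivity
  refine ⟨n * L + n, M⁻¹, σ, by positivity, hσ0.le, ?_⟩
  intro C hne hcl hcv F hF hsens x0 _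
  refine ⟨DecGD.isLDP_transcript hne hcl hcv (fun i f hf => (hF i f hf).2.1) hsens hσ0 hδ hδ' hε
    hεδ (le_of_eq ?_) x0, ?_⟩
  · rw [hσ, mul_div_cancel₀ _ hε.ne', mul_pow _ (Real.sqrt _), Real.sq_sqrt (by positivity)]
    ring
  intro f hf
  rw [DecGD.sqrt_mul_div_rpow_eq hm hM]
  rcases C.subsingleton_or_nontrivial with hC | hC
  · obtain ⟨p, hp, hmin, hi, hle⟩ := DecGD.utility_of_subsingleton (f := f) (η := M⁻¹) (σ := σ)
      (K := n * L + n) hC hne hcl x0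
    exact ⟨p, hp, hmin, hi, hle.trans (by positivity)⟩
  · obtain ⟨p, hp, hmin, hi, hle⟩ := DecGD.utility_of_nontrivial (f := f) hm hC₁ hB₁ hδ hδ' hε
      hεδ hTΛ hΛ1 (by linarith) (by linarith) (by linarith) (by linarith) hn hL hC hcl hcv
      (fun i => (hF i _ (hf i)).1) (fun i => (hF i _ (hf i)).2.1) (fun i => (hF i _ (hf i)).2.2)
      x0 rfl hσ
    exact ⟨p, hp, hmin, hi, hle.trans (le_of_eq (by ring))⟩
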